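/- Let $G$ be a finite directed acyclic graph with vertex set $V$, and let $(x_i)_{i\in V}$ be real random variables on a probability space with $$x_i=\sum_{j\in V} b_{ij}\,x_j+\varepsilon_i\qquad(i\in V),$$ where $b_{ij}\neq 0$ if and only if $j\to i$ is an edge of $G$, and the noise variables $\varepsilon_i$ are jointly independent, have finite variance, and are non-Gaussian (constants being regarded as Gaussian of variance $0$). Assume that the joint law is faithful to $G$: whenever $a\neq b$, $Z\subseteq V\setminus\{a,b\}$ and $x_a$, $x_b$ are conditionally independent given $(x_k)_{k\in Z}$, the vertices $a$ and $b$ are d-separated by $Z$ in $G$. A path between two vertices is a sequence of distinct vertices in which consecutive ones are joined by an edge in either direction; it is active (relative to $\emptyset$) if it contains no collider, i.e. no interior vertex at which both edges of the path point into that vertex. A frontdoor path between $x_i$ and $x_j$ is a directed path from $x_i$ to $x_j$ or from $x_j$ to $x_i$; a backdoor path is a path whose first edge points into $x_i$ and whose last edge points into $x_j$. Distinct vertices $x_i,x_j$ are in AP3 relation if there is an active frontdoor path between them but no active backdoor path between them. Write $x_i\in \mathrm{An}(x_j)$ if there is a directed path from $x_i$ to $x_j$. Let $r_i^j$ be the (population)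 residual of the simple linear least-squares regression of $x_j$ on $x_i$, and $r_j^i$ that of $x_i$ on $x_j$. Then, for distinct $i,j\in V$, the vertices $x_i,x_j$ are in AP3 relation if and only if $x_i$ and $x_j$ are dependent and one of the following holds: 1. $x_i$ is independent of $r_i^j$, and $x_j$ is not independent of $r_j^i$; 2. $x_i$ is not independent of $r_i^j$, and $x_j$ is independent of $r_j^i$. Moreover, case 1 corresponds to $x_i\in\mathrm{An}(x_j)$ and case 2 to $x_j\in\mathrm{An}(x_i)$: $x_i,x_j$ are in AP3 relation with $x_i\in \mathrm{An}(x_j)$ if and only if they are dependent and 1 holds, and they are in AP3 relation with $x_j\in \mathrm{An}(x_i)$ if and only if they are dependent and 2 holds. -/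

import Mathlib

open MeasureTheory ProbabilityTheory

namespace LinearSEM

section Graph

variable {V : Type*} (G : Digraph V)

/-- A directed graph is acyclic if no vertex lies on a directed cycle (in particular there are no
loops). -/
def IsAcyclic : Prop := ∀ v : V, ¬ Relation.TransGen G.Adj v v

/-- `IsAncestor G a b`: there is a directed path with at least one edge from `a` to `b`,
i.e. `a ∈ An(b)`, equivalently `b ∈ De(a)`. -/
def IsAncestor (a b : V) : Prop := Relation.TransGen G.Adj a b

/-- `p` is an (undirected) path from `a` to `b`: a list of pairwise distinct vertices, starting at
`a` and ending at `b`, in which consecutive vertices are joined by an edge, in either direction. -/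
structure IsPathBetween (a b : V) (p : List V) : Prop where
  nodup : p.Nodup
  head : p.head? = some a
  last : p.getLast? = some b
  chain : p.IsChain (fun u v => G.Adj u v ∨ G.Adj v u)

/-- `v` is a collider on `p`: it is an interior vertex of `p` and both edges of `p` at `v` point
into `v`. -/
def IsColliderOn (p : List V) (v : V) : Prop :=
  ∃ u w : V, [u, v, w] <:+: p ∧ G.Adj u v ∧ G.Adj w v

/-- `p` is active relative to `Z`: every vertex on it is either a non-collider outside `Z`, or a
collider that is in `Z` or has a descendant in `Z`. -/
def IsActive (Z : Set V) (p : List V) : Prop :=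
  ∀ v ∈ p, (¬ IsColliderOn G p v ∧ v ∉ Z) ∨
    (IsColliderOn G p v ∧ (v ∈ Z ∨ ∃ z ∈ Z, IsAncestor G v z))

/-- `a` and `b` are d-separated by `Z`: no path between them is active relative to `Z`. -/
def DSeparated (a b : V) (Z : Set V) : Prop :=
  ∀ p : List V, IsPathBetween G a b p → ¬ IsActive G Z p

/-- A frontdoor path from `a` to `b`: a path with at least one edge, all of whose edges point
from `a` towards `b`. -/
def IsFrontdoorPath (a b : V) (p : List V) : Prop :=
  IsPathBetween G a b p ∧ 2 ≤ p.length ∧ p.IsChain G.Adj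

/-- A backdoor path between `a` and `b`: its first edge points into `a`, its last edge points
into `b`. -/
def IsBackdoorPath (a b : V) (p : List V) : Prop :=
  IsPathBetween G a b p ∧ (∃ u : V, [a, u] <+: p ∧ G.Adj u a) ∧ (∃ w : V, [w, b] <:+ p ∧ G.Adj w b)

/-- `a` and `b` are in AP3 relation: there is an active frontdoor path between them (in one of the
two directions), but no active backdoor path. Active means active relative to the empty set. -/
def AP3 (a b : V) : Prop :=
  (∃ p : List V, (IsFrontdoorPath G a b p ∨ IsFrontdoorPath G b a p) ∧ IsActive G ∅ p) ∧
    ¬ ∃ p : List V, IsBackdoorPath G a b p ∧ IsActive G ∅ p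

end Graph

section Model

variable {V Ω : Type*} [Fintype V] [MeasurableSpace Ω]

/-- A linear non-Gaussian acyclic model with graph `G`, coefficient matrix `B` (`B i j` is the
coefficient from `j` to `i`), noise variables `ε` and observed variables `X`. The laws
`gaussianReal m v` include the point masses (`v = 0`), so the noise variables are also
non-degenerate. -/
structure IsLiNGAM (μ : Measure Ω) (G : Digraph V) (B : Matrix V V ℝ) (ε X : V → Ω → ℝ) :
    Prop where
  acyclic : IsAcyclic G
  coeff_ne_zero_iff : ∀ i j : V, B i j ≠ 0 ↔ G.Adj j i
  structural : ∀ (i : V) (ω : Ω), X i ω = ∑ j, B i j * X j ω + ε i ω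
  measurable_noise : ∀ i : V, Measurable (ε i)
  indep_noise : iIndepFun ε μ
  memLp_noise : ∀ i : V, MemLp (ε i) 2 μ
  nonGaussian_noise : ∀ (i : V) (m : ℝ) (v : NNReal), μ.map (ε i) ≠ gaussianReal m v

/-- Conditional independence `x_a ⊥ x_b | x_Z` of two coordinates given the coordinates in `Z`,
under a joint law `P` on `V → ℝ`. -/
def CondIndepCoord (P : Measure (V → ℝ)) [IsFiniteMeasure P] (a b : V) (Z : Set V) : Prop :=
  CondIndepFun
    (MeasurableSpace.comap (fun (x : V → ℝ) (k : Z) => x k) MeasurableSpace.pi)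
    (Measurable.comap_le (measurable_pi_lambda _ fun k => measurable_pi_apply (k : V)))
    (fun x : V → ℝ => x a) (fun x : V → ℝ => x b) P

/-- The joint law of `X` is faithful to `G`: all conditional independences between two
variables are given by d-separation. -/
def IsFaithful (μ : Measure Ω) [IsFiniteMeasure μ] (G : Digraph V) (X : V → Ω → ℝ) : Prop :=
  ∀ (a b : V) (Z : Set V), a ≠ b → a ∉ Z → b ∉ Z →
    CondIndepCoord (μ.map (fun ω v => X v ω)) a b Z → DSeparated G a b Z

/-- The population residual of `y` after simple linear least-squares regression (with intercept)
on `x`. -/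
noncomputable def residual (μ : Measure Ω) (y x : Ω → ℝ) : Ω → ℝ :=
  fun ω => (y ω - ∫ ω', y ω' ∂μ)
    - covariance x y μ / variance x μ * (x ω - ∫ ω', x ω' ∂μ)

end Model

end LinearSEM

/-! Acyclicity lets one solve the model as `X i = ∑ k, A i k * ε k`, where the matrix `A = 1 + B *
A` of total effects is supported on ancestor pairs. Everything is then read off from `A`.

The analytic input is the Darmois–Skitovich theorem,
`exists_map_eq_gaussianReal_of_indepFun_linear`: a noise variable occurring in two independent
linear forms is Gaussian. With non-Gaussian noise, independence of `X i` and the residual of `X j`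
therefore means that row `j` of `A` equals `c` times row `i` on the support of row `i`, with `c` the
regression slope. Its proof runs through cumulants. Joint characteristic functions factorize near 0,
which forces all moments to exist. A Vandermonde argument kills the high cumulants of the sum over
each class of variables with proportional coefficients. Finite moment generating functions follow,
and a zero-free one of finite order is Gaussian.

The graphical input is twofold. By `exists_active_backdoorPath` and `totalEffect_eq_mul`, if no
active backdoor path joins `i` to its descendant `j`, then all effects of ancestors of `i` on `j`
are mediated by `i`, so the rows are proportional. Conversely, if they are proportional, an active
backdoor path would join a parent `u` of `i` to `j` given `i`, whereas `X j = c * X i + N` with `N`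
free of all noise in `X i` and `X u` gives conditional independence, against faithfulness.
Faithfulness also enters through `IsLiNGAM.totalEffect_ne_zero`, which excludes cancellation of
total effects. -/

/-! ### Entire functions of finite order without zeros. -/

section EntireFunctions

open Complex Filter Topology Polynomial

/-- An entire function whose real part has polynomial growth is a polynomial. -/
theorem exists_polynomial_of_re_le {g : ℂ → ℂ} (hg : Differentiable ℂ g) {C : ℝ} (hC : 0 < C)
    {d : ℕ} (h : ∀ z, (g z).re ≤ C * (1 + ‖z‖) ^ d) :
    ∃ p : ℂ[X], ∀ z, g z = p.eval z := by
  -- Borel–Carathéodory on the disc of radius `2 * r` turns the one-sided bound on the real part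
  -- into `O(r ^ d)` for the modulus on the circle of radius `r`. Cauchy's estimate then gives `O(r
  -- ^ d / r ^ n)`, which tends to 0. The factor `3 ^ d` comes from `1 + 2 * r ≤ 3 * r`.
  have hzero : ∀ n, d < n → iteratedDeriv n g 0 = 0 := by
    intro n hn
    have hbound : ∀ r : ℝ, 1 ≤ r →
        ‖iteratedDeriv n g 0‖ ≤ n.factorial * ((2 * C * 3 ^ d + 3 * ‖g 0‖) * r ^ d) / r ^ n := by
      intro r hr
      have hr0 : 0 < r := by linarith
      refine norm_iteratedDeriv_le_of_forall_mem_sphere_norm_le n hr0 hg.diffContOnCl ?_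
      intro z hz
      have hz' : ‖z‖ = r := by simpa using hz
      have hM : 0 < C * (1 + 2 * r) ^ d := by positivity
      have key := Complex.borelCaratheodory (f := g) (R := 2 * r) (z := z) hM
        hg.differentiableOn (fun w hw => by
          have hw' : ‖w‖ < 2 * r := by simpa using hw
          refine (h w).trans ?_
          gcongr) (by positivity) (by simp [hz']; linarith)
      rw [hz'] at key
      have e1 : 2 * (C * (1 + 2 * r) ^ d) * r / (2 * r - r) = 2 * (C * (1 + 2 * r) ^ d) := by
        rw [show 2 * r - r = r by ring]; field_simp
      have e2 : ‖g 0‖ * (2 * r + r) / (2 * r - r) = 3 * ‖g 0‖ := by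
        rw [show 2 * r - r = r by ring]; field_simp; ring
      rw [e1, e2] at key
      have h1 : (1 + 2 * r) ^ d ≤ 3 ^ d * r ^ d := by
        rw [← mul_pow]; gcongr; linarith
      have h2 : 3 * ‖g 0‖ ≤ 3 * ‖g 0‖ * r ^ d :=
        le_mul_of_one_le_right (by positivity) (one_le_pow₀ hr)
      nlinarith
    have hlim : Tendsto (fun r : ℝ => n.factorial * ((2 * C * 3 ^ d + 3 * ‖g 0‖) * r ^ d) / r ^ n)
        atTop (𝓝 0) := by
      have h1 := (tendsto_pow_div_pow_atTop_zero (𝕜 := ℝ) hn).const_mul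
        (n.factorial * (2 * C * 3 ^ d + 3 * ‖g 0‖))
      rw [mul_zero] at h1
      refine h1.congr fun r => ?_
      ring
    have : ‖iteratedDeriv n g 0‖ ≤ 0 :=
      ge_of_tendsto hlim ((eventually_ge_atTop 1).mono fun r hr => hbound r hr)
    exact norm_le_zero_iff.1 this
  refine ⟨∑ n ∈ Finset.range (d + 1),
    Polynomial.C ((n.factorial : ℂ)⁻¹ * iteratedDeriv n g 0) * X ^ n, fun z => ?_⟩
  rw [← taylorSeries_eq_of_entire' 0 z hg, tsum_eq_sum (s := Finset.range (d + 1))]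
  · simp [eval_finsetSum]
  · intro n hn
    rw [hzero n (by simpa using hn)]
    simp

theorem tendsto_eval_mul_div_pow (p : ℂ[X]) (w : ℂ) :
    Tendsto (fun r : ℝ => p.eval (r * w) / (r : ℂ) ^ p.natDegree) atTop
      (𝓝 (p.leadingCoeff * w ^ p.natDegree)) := by
  have h : ∀ k ∈ Finset.range (p.natDegree + 1),
      Tendsto (fun r : ℝ => p.coeff k * w ^ k * (((r ^ k / r ^ p.natDegree : ℝ)) : ℂ)) atTop
        (𝓝 (p.coeff k * w ^ k * (((if k = p.natDegree then 1 else 0 : ℝ)) : ℂ))) := by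
    intro k hk
    refine Tendsto.const_mul _ ((continuous_ofReal.tendsto _).comp ?_)
    split_ifs with hkd
    · subst hkd
      refine tendsto_const_nhds.congr' ?_
      filter_upwards [eventually_gt_atTop 0] with r hr
      rw [div_self (by positivity)]
    · have : k < p.natDegree := by
        have := Finset.mem_range.1 hk
        omega
      exact tendsto_pow_div_pow_atTop_zero this
  have := tendsto_finsetSum _ h
  refine (this.congr fun r => ?_).trans_eq ?_
  · rw [eval_eq_sum_range, Finset.sum_div]
    refine Finset.sum_congr rfl fun k _ => ?_
    push_cast
    ring
  · congr 1
    rw [Finset.sum_eq_single p.natDegree]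
    · simp
    · intro k _ hk
      simp [hk]
    · simp

/-- If the real part of a polynomial satisfies the ridge inequality, the polynomial is at most
quadratic. -/
theorem natDegree_le_two_of_ridge (p : ℂ[X])
    (h : ∀ z : ℂ, (p.eval z).re ≤ (p.eval (z.re : ℂ)).re) : p.natDegree ≤ 2 := by
  by_contra! hd
  set d := p.natDegree with hd_def
  set c := p.leadingCoeff with hc_def
  have hc : c ≠ 0 := leadingCoeff_ne_zero.2 (by rintro rfl; simp [d] at hd)
  -- Apply the hypothesis at `r * w`, divide by `r ^ d` and let `r → ∞`: only the leading term
  -- survives.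
  have key : ∀ w : ℂ, (c * w ^ d).re ≤ c.re * w.re ^ d := by
    intro w
    have h1 := (continuous_re.tendsto _).comp (tendsto_eval_mul_div_pow p w)
    have h2 := (continuous_re.tendsto _).comp (tendsto_eval_mul_div_pow p (w.re : ℂ))
    have h3 := le_of_tendsto_of_tendsto h1 h2 (by
      filter_upwards [eventually_gt_atTop 0] with r hr
      have := h (r * w)
      simp only [Function.comp, ← ofReal_pow, div_ofReal_re]
      rw [re_ofReal_mul] at this
      push_cast at this
      gcongr)
    rw [← ofReal_pow, mul_comm c (ofReal _), re_ofReal_mul, mul_comm (_ ^ _)] at h3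
    exact h3
  -- In a direction where `c * w ^ d` is positive, `key` gives `‖c‖ ≤ ‖c‖ * |cos θ| ^ d`, so such
  -- directions are real.
  have hsin : ∀ θ : ℝ, (c * exp (d * θ * I)) = ‖c‖ → Real.sin θ = 0 := by
    intro θ hθ
    have h1 := key (exp (θ * I))
    rw [← exp_nat_mul, ← mul_assoc, hθ, ofReal_re, exp_ofReal_mul_I_re] at h1
    by_contra hs
    have hcos : |Real.cos θ| < 1 := by
      rw [← sq_lt_one_iff_abs_lt_one]
      have := Real.sin_sq_add_cos_sq θ
      have : 0 < Real.sin θ ^ 2 := by positivity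
      linarith
    have h2 : c.re * Real.cos θ ^ d ≤ ‖c‖ * |Real.cos θ| ^ d := by
      calc c.re * Real.cos θ ^ d ≤ |c.re * Real.cos θ ^ d| := le_abs_self _
        _ = |c.re| * |Real.cos θ| ^ d := by rw [abs_mul, abs_pow]
        _ ≤ _ := by gcongr; exact abs_re_le_norm c
    have h3 : |Real.cos θ| ^ d < 1 := pow_lt_one₀ (abs_nonneg _) hcos (by omega)
    have h4 : 0 < ‖c‖ := norm_pos_iff.2 hc
    nlinarith
  have hd0 : (d : ℝ) ≠ 0 := by positivity
  have hd0' : (d : ℂ) ≠ 0 := by exact_mod_cast hd0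
  -- Two consecutive positive directions differ by the angle `2π / d`. Both are multiples of `π`, so
  -- `d` divides 2.
  have hval : ∀ x : ℝ, x = -arg c ∨ x = -arg c + 2 * Real.pi → c * exp ((x : ℂ) * I) = ‖c‖ := by
    intro x hx
    have : exp ((x : ℂ) * I) = exp (-(arg c * I)) := by
      rcases hx with rfl | rfl
      · push_cast; ring_nf
      · push_cast
        rw [add_mul, exp_add, exp_two_pi_mul_I]
        ring_nf
    rw [this]
    nth_rewrite 1 [← norm_mul_exp_arg_mul_I c]
    rw [mul_assoc, ← exp_add]
    simp
  have s1 := hsin (-arg c / d) (by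
    rw [← hval _ (Or.inl rfl)]
    push_cast
    congr 3
    rw [mul_div_cancel₀ _ hd0'])
  have s2 := hsin ((-arg c + 2 * Real.pi) / d) (by
    rw [← hval _ (Or.inr rfl)]
    push_cast
    congr 3
    rw [mul_div_cancel₀ _ hd0'])
  obtain ⟨m, hm⟩ := Real.sin_eq_zero_iff.1 s1
  obtain ⟨n, hn⟩ := Real.sin_eq_zero_iff.1 s2
  have hpi := Real.pi_pos
  have e : ((n - m : ℤ) : ℝ) * d = 2 := by
    have : ((n : ℝ) * Real.pi - m * Real.pi) * d = 2 * Real.pi := by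
      rw [hn, hm]; field_simp; ring
    push_cast
    have h2 : (((n : ℝ) - m) * d - 2) * Real.pi = 0 := by linarith
    rcases mul_eq_zero.1 h2 with h2 | h2
    · linarith
    · exact absurd h2 hpi.ne'
  have e' : (n - m) * (d : ℤ) = 2 := by exact_mod_cast e
  have hdvd : (d : ℤ) ∣ 2 := Dvd.intro_left _ e'
  have := Int.le_of_dvd (by norm_num) hdvd
  omega

/-- A nowhere vanishing entire function is the exponential of an entire function. -/
theorem exists_exp_eq_of_entire {F : ℂ → ℂ} (hF : Differentiable ℂ F) (hne : ∀ z, F z ≠ 0) :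
    ∃ g : ℂ → ℂ, Differentiable ℂ g ∧ ∀ z, F z = exp (g z) := by
  have hF' : Differentiable ℂ (deriv F) := hF.contDiff.differentiable_deriv_two
  -- A primitive of the logarithmic derivative, normalized at 0 so that the constant `F * exp (-g)`
  -- equals 1.
  obtain ⟨g, hg0, hg⟩ := (Differentiable.isExactOn_univ (hF'.div hF hne)).with_val_at 0
    (log (F 0))
  have hgd : ∀ z, HasDerivAt g (deriv F z / F z) z := fun z => hg z trivial
  refine ⟨g, fun z => (hgd z).differentiableAt, fun z => ?_⟩
  have hconst : ∀ z, F z * exp (-g z) = F 0 * exp (-g 0) := by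
    intro z
    refine is_const_of_deriv_eq_zero (f := fun z => F z * exp (-g z)) ?_ ?_ z 0
    · exact hF.mul (fun z => ((hgd z).neg.cexp).differentiableAt)
    · intro w
      have := ((hF w).hasDerivAt.mul (hgd w).neg.cexp).deriv
      refine this.trans ?_
      have := hne w
      field_simp
      ring
  have := hconst z
  rw [hg0, exp_neg (log _), exp_log (hne 0), mul_inv_cancel₀ (hne 0), exp_neg] at this
  rwa [mul_inv_eq_one₀ (exp_ne_zero _)] at this

end EntireFunctions

/-! ### Moments, cumulants and moment generating functions. -/

section MomentGenerating

open Complex Filter Topology Polynomial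

variable {ν : Measure ℝ}

theorem ofReal_integral_pow (n : ℕ) :
    ((∫ x, x ^ n ∂ν : ℝ) : ℂ) = ∫ x : ℝ, (x : ℂ) ^ n ∂ν := by
  rw [← integral_complex_ofReal]
  simp

theorem integrable_pow_of_memLp_id [IsFiniteMeasure ν] {n : ℕ} (h : MemLp id n ν) :
    Integrable (fun x : ℝ => x ^ n) ν :=
  h.integrable_norm_pow'.mono' (by fun_prop) (ae_of_all _ fun x => by simp)

theorem re_mem_interior_integrableExpSet
    (hint : ∀ t : ℝ, Integrable (fun x => Real.exp (t * x)) ν) (z : ℂ) :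
    z.re ∈ interior (integrableExpSet id ν) := by
  have : integrableExpSet id ν = Set.univ := Set.eq_univ_of_forall hint
  simp [this]

theorem differentiable_complexMGF (hint : ∀ t : ℝ, Integrable (fun x => Real.exp (t * x)) ν) :
    Differentiable ℂ (complexMGF id ν) := fun z =>
  (hasDerivAt_complexMGF (re_mem_interior_integrableExpSet hint z)).differentiableAt

variable [IsProbabilityMeasure ν]

/-- A probability measure with exponential moments of all orders, whose moment generating function
has no complex zeros and finite order of growth, is Gaussian. -/
theorem exists_eq_gaussianReal_of_complexMGF_ne_zero
    (hint : ∀ t : ℝ, Integrable (fun x => Real.exp (t * x)) ν)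
    (hne : ∀ z, complexMGF id ν z ≠ 0) {C : ℝ} (hC : 0 < C) {d : ℕ}
    (hgrowth : ∀ x : ℝ, mgf id ν x ≤ Real.exp (C * (1 + |x|) ^ d)) :
    ∃ m v, ν = gaussianReal m v := by
  have hF := differentiable_complexMGF hint
  obtain ⟨g, hgd, hg⟩ := exists_exp_eq_of_entire hF hne
  have hnorm : ∀ z, Real.exp (g z).re = ‖complexMGF id ν z‖ := fun z => by
    rw [hg, norm_exp]
  obtain ⟨p, hp⟩ := exists_polynomial_of_re_le hgd hC (d := d) (fun z => by
    have h1 : Real.exp (g z).re ≤ Real.exp (C * (1 + ‖z‖) ^ d) := by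
      rw [hnorm]
      refine norm_complexMGF_le_mgf.trans ((hgrowth z.re).trans ?_)
      gcongr
      exact abs_re_le_norm z
    exact Real.exp_le_exp.1 h1)
  -- The ridge property `|M(z)| ≤ M(Re z)` of a moment generating function passes to the real part
  -- of the exponent.
  have hdeg : p.natDegree ≤ 2 := natDegree_le_two_of_ridge p fun z => by
    rw [← hp, ← hp, ← Real.exp_le_exp, hnorm, hnorm, complexMGF_ofReal, norm_real,
      Real.norm_of_nonneg mgf_nonneg]
    exact norm_complexMGF_le_mgf
  obtain ⟨c₀, c₁, c₂, hc⟩ : ∃ c₀ c₁ c₂ : ℂ, ∀ z, g z = c₀ + c₁ * z + c₂ * z ^ 2 := by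
    refine ⟨p.coeff 0, p.coeff 1, p.coeff 2, fun z => ?_⟩
    rw [hp, eval_eq_sum_range' (n := 3) (by omega)]
    simp [Finset.sum_range_succ]
  have hFz : complexMGF id ν = fun z => exp (c₀ + c₁ * z + c₂ * z ^ 2) := by
    funext z; rw [hg, hc]
  have h0 : exp c₀ = 1 := by
    have := congrFun hFz 0
    simpa [complexMGF] using this.symm
  have hder : ∀ z, HasDerivAt (fun z : ℂ => exp (c₀ + c₁ * z + c₂ * z ^ 2))
      (exp (c₀ + c₁ * z + c₂ * z ^ 2) * (c₁ + 2 * c₂ * z)) z := by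
    intro z
    have h1 : HasDerivAt (fun z : ℂ => c₀ + c₁ * z + c₂ * z ^ 2) (c₁ + 2 * c₂ * z) z := by
      have := (((hasDerivAt_id z).const_mul c₁).const_add c₀).add
        (((hasDerivAt_id z).pow 2).const_mul c₂)
      convert! this using 1
      simp; ring
    exact h1.cexp
  have hder1 : deriv (complexMGF id ν) =
      fun z => exp (c₀ + c₁ * z + c₂ * z ^ 2) * (c₁ + 2 * c₂ * z) := by
    rw [hFz]; funext z; exact (hder z).deriv
  have hder2 : deriv (deriv (complexMGF id ν)) 0 = c₁ ^ 2 + 2 * c₂ := by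
    rw [hder1]
    have h2 : HasDerivAt (fun z : ℂ => c₁ + 2 * c₂ * z) (2 * c₂) 0 := by
      simpa using ((hasDerivAt_id (0 : ℂ)).const_mul (2 * c₂)).const_add c₁
    refine ((hder 0).mul h2).deriv.trans ?_
    simp [h0]; ring
  -- Matching the first two derivatives at 0 makes `c₁` the mean and `c₂` half the variance, so
  -- reality and the sign of `c₂` come for free.
  have hm1 := iteratedDeriv_complexMGF (re_mem_interior_integrableExpSet hint 0) 1
  have hm2 := iteratedDeriv_complexMGF (re_mem_interior_integrableExpSet hint 0) 2
  rw [iteratedDeriv_one, hder1] at hm1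
  rw [iteratedDeriv_succ, iteratedDeriv_one, hder2] at hm2
  set m : ℝ := ∫ x, x ∂ν with hm
  have hc1 : c₁ = m := by
    have e : (∫ x : ℝ, (x : ℂ) ∂ν) = (m : ℂ) := integral_ofReal
    simpa [h0, e] using hm1
  have hc2 : c₂ = ((variance id ν / 2 : ℝ) : ℂ) := by
    have hmem : MemLp (id : ℝ → ℝ) 2 ν := by
      have := memLp_of_mem_interior_integrableExpSet (X := id) (μ := ν)
        (by simpa using re_mem_interior_integrableExpSet hint 0) 2
      simpa using this
    have hv := variance_eq_sub hmem
    have hv' : variance id ν = ∫ x : ℝ, x ^ 2 ∂ν - m ^ 2 := by simpa using hv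
    have : c₁ ^ 2 + 2 * c₂ = ((∫ x : ℝ, x ^ 2 ∂ν : ℝ) : ℂ) := by
      rw [ofReal_integral_pow]; simpa using hm2
    rw [hv']
    push_cast
    rw [← this, hc1]
    ring
  refine ⟨m, (variance id ν).toNNReal, Measure.ext_of_charFun (funext fun t => ?_)⟩
  rw [charFun_gaussianReal, ← complexMGF_id_mul_I, hFz]
  simp only
  rw [add_assoc, exp_add, h0, one_mul, hc1, hc2, Real.coe_toNNReal _ (variance_nonneg _ _)]
  congr 1
  push_cast
  rw [mul_pow, I_sq]
  ring

/-- A probability measure whose moments are the derivatives at `0` of an entire function has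
exponential moments of all orders. -/
theorem integrable_exp_of_moments_eq (hmom : ∀ n : ℕ, MemLp id n ν) {E : ℂ → ℂ}
    (hE : Differentiable ℂ E)
    (h : ∀ n : ℕ, iteratedDeriv n E 0 = ((∫ x, x ^ n ∂ν : ℝ) : ℂ)) (t : ℝ) :
    Integrable (fun x => Real.exp (t * x)) ν := by
  have hmi : ∀ n : ℕ, Integrable (fun x : ℝ => x ^ n) ν := fun n =>
    integrable_pow_of_memLp_id (hmom n)
  -- `exp ≤ 2 * cosh`, and the series of `cosh` has only even powers: its terms are nonnegative, so
  -- Tonelli exchanges sum and integral. The resulting series is the even part of the Taylor series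
  -- of `E` at `t`, which converges absolutely.
  have hcosh : Integrable (fun x => Real.cosh (t * x)) ν := by
    refine ⟨(by fun_prop), ?_⟩
    have hs : Summable fun n : ℕ => t ^ (2 * n) / (2 * n).factorial * ∫ x, x ^ (2 * n) ∂ν := by
      have h1 := (hasSum_taylorSeries_of_entire hE 0 (t : ℂ)).summable.norm
      have h2 := h1.comp_injective (i := fun n : ℕ => 2 * n)
        (fun a b hab => by simpa using hab)
      refine h2.congr fun n => ?_
      have hnn : 0 ≤ ∫ x : ℝ, x ^ (2 * n) ∂ν :=
        integral_nonneg fun x => (even_two_mul n).pow_nonneg x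
      simp only [Function.comp, h, sub_zero, smul_eq_mul, norm_mul, norm_inv, Complex.norm_natCast,
        norm_pow, norm_real, Real.norm_of_nonneg hnn, Real.norm_eq_abs, (even_two_mul n).pow_abs]
      ring
    have heq : ∀ x : ℝ, ‖Real.cosh (t * x)‖ₑ =
        ∑' n : ℕ, ENNReal.ofReal (t ^ (2 * n) / (2 * n).factorial * x ^ (2 * n)) := by
      intro x
      have hc := Real.hasSum_cosh (t * x)
      rw [Real.enorm_of_nonneg (Real.cosh_pos _).le, ← hc.tsum_eq, ENNReal.ofReal_tsum_of_nonneg _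
        hc.summable]
      · refine tsum_congr fun n => ?_
        rw [mul_pow]; ring_nf
      · intro n
        have := (even_two_mul n).pow_nonneg (t * x)
        positivity
    have hterm : ∀ n : ℕ, ∀ x : ℝ, 0 ≤ t ^ (2 * n) / (2 * n).factorial * x ^ (2 * n) := by
      intro n x
      have := (even_two_mul n).pow_nonneg t
      have := (even_two_mul n).pow_nonneg x
      positivity
    rw [hasFiniteIntegral_def]
    simp_rw [heq]
    rw [lintegral_tsum fun n => by fun_prop]
    have : ∀ n : ℕ, ∫⁻ x : ℝ, ENNReal.ofReal (t ^ (2 * n) / (2 * n).factorial * x ^ (2 * n)) ∂ν =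
        ENNReal.ofReal (t ^ (2 * n) / (2 * n).factorial * ∫ x, x ^ (2 * n) ∂ν) := by
      intro n
      rw [← integral_const_mul, ofReal_integral_eq_lintegral_ofReal ((hmi _).const_mul _)
        (ae_of_all _ (hterm n))]
    simp_rw [this]
    rw [← ENNReal.ofReal_tsum_of_nonneg _ hs]
    · exact ENNReal.ofReal_lt_top
    · intro n
      rw [← integral_const_mul]
      exact integral_nonneg (hterm n)
  refine (hcosh.const_mul 2).mono' (by fun_prop) (ae_of_all _ fun x => ?_)
  rw [Real.norm_of_nonneg (Real.exp_pos _).le, Real.cosh_eq]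
  have := Real.exp_pos (-(t * x))
  linarith

/-- The exponential moments just obtained make the left side entire, and both sides have the same
Taylor coefficients at 0. -/
theorem complexMGF_eq_of_moments_eq (hmom : ∀ n : ℕ, MemLp id n ν) {E : ℂ → ℂ}
    (hE : Differentiable ℂ E)
    (h : ∀ n : ℕ, iteratedDeriv n E 0 = ((∫ x, x ^ n ∂ν : ℝ) : ℂ)) :
    complexMGF id ν = E := by
  have hint := integrable_exp_of_moments_eq hmom hE h
  funext z
  rw [← taylorSeries_eq_of_entire' 0 z hE,
    ← taylorSeries_eq_of_entire' 0 z (differentiable_complexMGF hint)]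
  refine tsum_congr fun n => ?_
  rw [h, iteratedDeriv_complexMGF (re_mem_interior_integrableExpSet hint 0), ofReal_integral_pow]
  simp

/-- Leibniz's rule for `f' = l * f`, which is the recursion between moments and cumulants. The field
stays general because it serves a characteristic function over `ℝ` and the exponential of a
polynomial over `ℂ`. -/
theorem iteratedDeriv_succ_of_deriv_eq_mul {𝕜 : Type*} [NontriviallyNormedField 𝕜]
    [NormedAlgebra 𝕜 ℂ] {f l : 𝕜 → ℂ} {x : 𝕜} (n : ℕ) (hf : ContDiffAt 𝕜 n f x)
    (hl : ContDiffAt 𝕜 n l x) (h : deriv f =ᶠ[𝓝 x] l * f) :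
    iteratedDeriv (n + 1) f x = ∑ i ∈ Finset.range (n + 1),
      (n.choose i : ℂ) * iteratedDeriv i l x * iteratedDeriv (n - i) f x := by
  rw [iteratedDeriv_succ', h.iteratedDeriv_eq, iteratedDeriv_mul hl hf]

theorem iteratedDeriv_eval_zero (p : ℂ[X]) (n : ℕ) :
    iteratedDeriv n (fun z => p.eval z) 0 = n.factorial * p.coeff n := by
  have h : ∀ n : ℕ, iteratedDeriv n (fun z => p.eval z) =
      fun z => (derivative^[n] p).eval z := by
    intro n
    induction n with
    | zero => simp
    | succ n ih =>
      rw [iteratedDeriv_succ, ih, Function.iterate_succ_apply']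
      funext z
      exact Polynomial.deriv _
  rw [h]
  simp only
  rw [← coeff_zero_eq_eval_zero, coeff_iterate_derivative]
  simp [Nat.descFactorial_self]

theorem contDiff_charFun_of_moments (hmom : ∀ n : ℕ, MemLp id n ν) (n : ℕ∞) :
    ContDiff ℝ n (charFun ν) := contDiff_charFun' hmom

theorem contDiffAt_logDeriv_charFun (hmom : ∀ n : ℕ, MemLp id n ν) (n : ℕ) :
    ContDiffAt ℝ n (logDeriv (charFun ν)) 0 := by
  have h1 : ContDiff ℝ n (deriv (charFun ν)) :=
    ((contDiff_succ_iff_deriv (n := n)).1 (contDiff_charFun_of_moments hmom (n + 1 : ℕ))).2.2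
  have h2 : ContDiff ℝ n (charFun ν) := contDiff_charFun_of_moments hmom n
  have h3 : logDeriv (charFun ν) = deriv (charFun ν) * (charFun ν)⁻¹ := by
    rw [logDeriv, div_eq_mul_inv]
  rw [h3]
  exact h1.contDiffAt.mul (h2.contDiffAt.inv (by simp))

theorem eventually_charFun_ne_zero : ∀ᶠ t in 𝓝 0, charFun ν t ≠ 0 :=
  continuous_charFun.continuousAt.eventually_ne (by simp)

/-- If all but finitely many cumulants vanish, the moments are the derivatives at `0` of the
exponential of a polynomial. -/
theorem exists_polynomial_moments_eq (hmom : ∀ n : ℕ, MemLp id n ν) {N : ℕ}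
    (hN : ∀ n, N ≤ n → iteratedDeriv n (logDeriv (charFun ν)) 0 = 0) :
    ∃ P : ℂ[X], ∀ n : ℕ,
      iteratedDeriv n (fun z => exp (P.eval z)) 0 = ((∫ x, x ^ n ∂ν : ℝ) : ℂ) := by
  set c : ℕ → ℂ := fun i => iteratedDeriv i (logDeriv (charFun ν)) 0 with hc
  -- The cumulant generating polynomial. Since `c i` is the derivative of order `i + 1` of the
  -- logarithm of the characteristic function, it carries the factor `I ^ (i + 1)`, removed here.
  -- There is no constant term, so `exp P` starts with moment 1.
  set P : ℂ[X] := ∑ i ∈ Finset.range N,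
    Polynomial.C (c i / (I ^ (i + 1) * (i + 1).factorial)) * X ^ (i + 1) with hP
  have hPcoeff : ∀ n, (derivative P).coeff n * n.factorial = c n / I ^ (n + 1) := by
    intro n
    rw [coeff_derivative, hP, finsetSum_coeff]
    simp only [coeff_C_mul, coeff_X_pow, add_left_inj, mul_ite, mul_one, mul_zero]
    rw [Finset.sum_ite_eq]
    split_ifs with hn
    · rw [Nat.factorial_succ]
      have : (n.factorial : ℂ) ≠ 0 := by exact_mod_cast n.factorial_ne_zero
      have : ((n : ℂ) + 1) ≠ 0 := by exact_mod_cast n.succ_ne_zero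
      push_cast
      field_simp
    · rw [hc]; simp only; rw [hN n (by simpa using hn)]; simp
  have hPdiff : ∀ n : ℕ, ContDiff ℂ n (fun z => exp (P.eval z)) := fun n =>
    (P.contDiff_aeval n).cexp
  have hrecE : ∀ n : ℕ, iteratedDeriv (n + 1) (fun z => exp (P.eval z)) 0 =
      ∑ i ∈ Finset.range (n + 1), (n.choose i : ℂ) * (c i / I ^ (i + 1)) *
        iteratedDeriv (n - i) (fun z => exp (P.eval z)) 0 := by
    intro n
    rw [iteratedDeriv_succ_of_deriv_eq_mul (l := fun z => (derivative P).eval z) n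
      (hPdiff n).contDiffAt ((derivative P).contDiff_aeval n).contDiffAt]
    · refine Finset.sum_congr rfl fun i _ => ?_
      rw [iteratedDeriv_eval_zero, ← hPcoeff]
      ring
    · refine Eventually.of_forall fun z => ?_
      refine (P.hasDerivAt z).cexp.deriv.trans ?_
      simp [mul_comm]
  have hrecM : ∀ n : ℕ, ((∫ x, x ^ (n + 1) ∂ν : ℝ) : ℂ) =
      ∑ i ∈ Finset.range (n + 1), (n.choose i : ℂ) * (c i / I ^ (i + 1)) *
        ((∫ x, x ^ (n - i) ∂ν : ℝ) : ℂ) := by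
    intro n
    have h := iteratedDeriv_succ_of_deriv_eq_mul (l := logDeriv (charFun ν)) n
      (contDiff_charFun_of_moments hmom n).contDiffAt (contDiffAt_logDeriv_charFun hmom n) (by
        filter_upwards [eventually_charFun_ne_zero (ν := ν)] with t ht
        simp [logDeriv, ht])
    rw [iteratedDeriv_charFun_zero (hmom _)] at h
    have hI : (I ^ (n + 1)) ≠ 0 := pow_ne_zero _ I_ne_zero
    refine mul_left_cancel₀ hI ?_
    refine h.trans ?_
    rw [Finset.mul_sum]
    refine Finset.sum_congr rfl fun i hi => ?_
    rw [iteratedDeriv_charFun_zero (hmom _)]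
    have hi' : i ≤ n := by
      have := Finset.mem_range.1 hi
      omega
    have : I ^ (n + 1) = I ^ (i + 1) * I ^ (n - i) := by
      rw [← pow_add]; congr 1; omega
    rw [this]
    have hI' : (I ^ (i + 1)) ≠ 0 := pow_ne_zero _ I_ne_zero
    field_simp
    simp only [hc]
    ring
  -- Both sequences obey the same recursion with the same initial value.
  refine ⟨P, fun n => ?_⟩
  induction n using Nat.strong_induction_on with
  | _ n ih =>
    cases n with
    | zero =>
      have : P.eval 0 = 0 := by simp [hP, eval_finsetSum]
      simp [this]
    | succ n =>
      rw [hrecE, hrecM]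
      refine Finset.sum_congr rfl fun i _ => ?_
      rw [ih (n - i) (by omega)]

end MomentGenerating

/-! ### Moments from local factorization of characteristic functions. -/

section MixedMoments

open Complex Filter Topology

theorem norm_exp_mul_I_sub_one_le (x : ℝ) : ‖exp ((x : ℂ) * I) - 1‖ ≤ |x| := by
  have := Real.norm_exp_I_mul_ofReal_sub_one_le (x := x)
  rwa [mul_comm, Real.norm_eq_abs] at this

theorem tendsto_norm_exp_sub_one_div (x : ℝ) :
    Tendsto (fun n : ℕ => ‖exp ((((n : ℝ) + 1)⁻¹ * x : ℝ) * I) - 1‖ / ((n : ℝ) + 1)⁻¹) atTop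
      (𝓝 |x|) := by
  have hd : HasDerivAt (fun h : ℝ => exp ((h * x : ℝ) * I)) (x * I) 0 := by
    have h1 : HasDerivAt (fun h : ℝ => ((h * x : ℝ) : ℂ) * I) (x * I) 0 := by
      have := ((hasDerivAt_id (0 : ℝ)).mul_const x).ofReal_comp.mul_const I
      simpa using this
    simpa using h1.cexp
  have h2 := hd.tendsto_slope_zero
  have h3 : Tendsto (fun n : ℕ => ((n : ℝ) + 1)⁻¹) atTop (𝓝[≠] 0) := by
    refine tendsto_nhdsWithin_iff.2 ⟨by simpa using tendsto_one_div_add_atTop_nhds_zero_nat (𝕜 := ℝ),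
      Eventually.of_forall fun n => ?_⟩
    have : (0 : ℝ) < ((n : ℝ) + 1)⁻¹ := by positivity
    exact this.ne'
  have h4 := (h2.comp h3).norm
  have e : ‖(x : ℂ) * I‖ = |x| := by simp
  rw [e] at h4
  refine h4.congr fun n => ?_
  have : (0 : ℝ) < (n : ℝ) + 1 := by positivity
  simp only [Function.comp, norm_smul, zero_add, zero_mul, ofReal_zero, exp_zero,
    inv_inv, Real.norm_of_nonneg this.le]
  rw [div_inv_eq_mul, mul_comm]

/-- The even powers of `‖exp (i h x) - 1‖`. -/
noncomputable def expSubOnePow (p : ℕ) (h x : ℝ) : ℝ := ‖exp ((h * x : ℝ) * I) - 1‖ ^ (2 * p)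

theorem measurable_expSubOnePow (p : ℕ) (h : ℝ) : Measurable (expSubOnePow p h) := by
  unfold expSubOnePow
  fun_prop

theorem expSubOnePow_nonneg (p : ℕ) (h x : ℝ) : 0 ≤ expSubOnePow p h x := by
  unfold expSubOnePow
  positivity

theorem expSubOnePow_le (p : ℕ) (h x : ℝ) : expSubOnePow p h x ≤ 2 ^ (2 * p) := by
  refine pow_le_pow_left₀ (norm_nonneg _) ((norm_sub_le _ _).trans ?_) _
  rw [norm_exp_ofReal_mul_I, norm_one]
  norm_num

theorem expSubOnePow_div_le (p : ℕ) {h : ℝ} (hh : 0 < h) (x : ℝ) :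
    expSubOnePow p h x / h ^ (2 * p) ≤ |x| ^ (2 * p) := by
  rw [expSubOnePow, ← div_pow]
  refine pow_le_pow_left₀ (div_nonneg (norm_nonneg _) hh.le) ?_ _
  rw [div_le_iff₀ hh]
  refine (norm_exp_mul_I_sub_one_le _).trans ?_
  rw [abs_mul, abs_of_pos hh, mul_comm]

/-- The even powers of `‖exp (i h x) - 1‖` are trigonometric polynomials with frequencies in
`[-p h, p h]`. -/
theorem exists_expSubOnePow_eq_sum (p : ℕ) : ∃ w : ℕ → ℂ, ∀ h x : ℝ,
    ((expSubOnePow p h x : ℝ) : ℂ) = ∑ m ∈ Finset.range (2 * p + 1),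
      w m * exp (((h * (m - p) : ℝ) * x : ℝ) * I) := by
  refine ⟨fun m => (-1) ^ p * (-1) ^ (2 * p - m) * ((2 * p).choose m), fun h x => ?_⟩
  set e := exp ((h * x : ℝ) * I) with he
  set e' := exp (-((h * x : ℝ) * I)) with he'
  have hee : e * e' = 1 := by rw [he, he', ← exp_add]; simp
  have hconj : (starRingEnd ℂ) e = e' := by
    rw [he, he', ← exp_conj]; simp
  have h1 : ((expSubOnePow p h x : ℝ) : ℂ) = (-1) ^ p * e' ^ p * (e - 1) ^ (2 * p) := by
    have : ((‖e - 1‖ ^ 2 : ℝ) : ℂ) = -1 * e' * (e - 1) ^ 2 := by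
      rw [ofReal_pow, ← mul_conj']
      simp only [map_sub, map_one, hconj]
      linear_combination (e - 1) * hee
    rw [expSubOnePow, pow_mul, pow_mul, ← mul_pow, ← mul_pow, ← this, ofReal_pow]
  rw [h1, sub_eq_add_neg, add_pow, Finset.mul_sum]
  refine Finset.sum_congr rfl fun m _ => ?_
  have : exp (((h * (m - p) : ℝ) * x : ℝ) * I) = e' ^ p * e ^ m := by
    rw [he, he', ← exp_nat_mul, ← exp_nat_mul, ← exp_add]
    congr 1
    push_cast
    ring
  rw [this]
  ring

variable {Ω : Type*} [MeasurableSpace Ω] {μ : Measure Ω} [IsProbabilityMeasure μ]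

theorem integrable_expSubOnePow (p : ℕ) (h : ℝ) {Z : Ω → ℝ} (hZ : Measurable Z) :
    Integrable (fun ω => expSubOnePow p h (Z ω)) μ :=
  Integrable.of_bound ((measurable_expSubOnePow p h).comp hZ).aestronglyMeasurable (2 ^ (2 * p))
    (ae_of_all _ fun ω => by
      rw [Real.norm_of_nonneg (expSubOnePow_nonneg _ _ _)]
      exact expSubOnePow_le _ _ _)

theorem integrable_exp_mul_I {Z : Ω → ℝ} (hZ : Measurable Z) :
    Integrable (fun ω => exp ((Z ω : ℝ) * I)) μ :=
  Integrable.of_bound (by fun_prop) 1 (ae_of_all _ fun ω => by rw [norm_exp_ofReal_mul_I])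

/-- The factorization is available only at small frequencies, and a trigonometric polynomial with
frequencies in `[-h p, h p]` sees no others. These bounded surrogates for even powers thus behave as
if the variables were independent. -/
theorem integral_expSubOnePow_mul {X Y : Ω → ℝ} (hX : Measurable X) (hY : Measurable Y) {δ : ℝ}
    (hfac : ∀ s t : ℝ, |s| < δ → |t| < δ →
      ∫ ω, exp ((s * X ω + t * Y ω : ℝ) * I) ∂μ =
        (∫ ω, exp ((s * X ω : ℝ) * I) ∂μ) * ∫ ω, exp ((t * Y ω : ℝ) * I) ∂μ) (p : ℕ) {h : ℝ}
    (h0 : 0 < h) (hhp : h * p < δ) :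
    ∫ ω, expSubOnePow p h (X ω) * expSubOnePow p h (Y ω) ∂μ =
      (∫ ω, expSubOnePow p h (X ω) ∂μ) * ∫ ω, expSubOnePow p h (Y ω) ∂μ := by
  obtain ⟨w, hw⟩ := exists_expSubOnePow_eq_sum p
  have hfreq : ∀ m ∈ Finset.range (2 * p + 1), |h * ((m : ℝ) - p)| < δ := by
    intro m hm
    have : (m : ℝ) ≤ 2 * p := by
      have := Finset.mem_range.1 hm
      exact_mod_cast (by omega : m ≤ 2 * p)
    have hm0 : (0 : ℝ) ≤ m := by positivity
    have : |(m : ℝ) - p| ≤ p := abs_le.2 ⟨by linarith, by linarith⟩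
    rw [abs_mul, abs_of_pos h0]
    exact (mul_le_mul_of_nonneg_left this h0.le).trans_lt hhp
  have hexp : ∀ (Z : Ω → ℝ), Measurable Z → ((∫ ω, expSubOnePow p h (Z ω) ∂μ : ℝ) : ℂ) =
      ∑ m ∈ Finset.range (2 * p + 1), w m *
        ∫ ω, exp (((h * (m - p) : ℝ) * Z ω : ℝ) * I) ∂μ := by
    intro Z hZ
    rw [← integral_complex_ofReal]
    simp_rw [hw]
    rw [integral_finsetSum _ fun m _ => (integrable_exp_mul_I (by fun_prop)).const_mul _]
    simp_rw [integral_const_mul]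
  have hmul : ∀ (m k : ℕ) (ω : Ω),
      w m * exp (((h * (m - p) : ℝ) * X ω : ℝ) * I) *
        (w k * exp (((h * (k - p) : ℝ) * Y ω : ℝ) * I)) =
      (w m * w k) * exp (((h * (m - p) : ℝ) * X ω + (h * (k - p) : ℝ) * Y ω : ℝ) * I) := by
    intro m k ω
    rw [ofReal_add, add_mul, exp_add]
    ring
  have : ((∫ ω, expSubOnePow p h (X ω) * expSubOnePow p h (Y ω) ∂μ : ℝ) : ℂ) =
      (∫ ω, expSubOnePow p h (X ω) ∂μ : ℝ) * (∫ ω, expSubOnePow p h (Y ω) ∂μ : ℝ) := by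
    rw [hexp X hX, hexp Y hY, Finset.sum_mul_sum, ← integral_complex_ofReal]
    simp_rw [ofReal_mul (expSubOnePow _ _ _), hw, Finset.sum_mul_sum, hmul]
    rw [integral_finsetSum _ fun m _ => integrable_finsetSum _ fun k _ =>
      (integrable_exp_mul_I (by fun_prop)).const_mul _]
    refine Finset.sum_congr rfl fun m hm => ?_
    rw [integral_finsetSum _ fun k _ => (integrable_exp_mul_I (by fun_prop)).const_mul _]
    refine Finset.sum_congr rfl fun k hk => ?_
    rw [integral_const_mul, hfac _ _ (hfreq m hm) (hfreq k hk)]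
    ring
  exact_mod_cast this

/-- If the joint characteristic function of `X` and `Y` factorizes near the origin, then mixed even
moments are bounded by the product of the moments. -/
theorem lintegral_mixed_moment_le {X Y : Ω → ℝ} (hX : Measurable X) (hY : Measurable Y) {δ : ℝ}
    (hδ : 0 < δ)
    (hfac : ∀ s t : ℝ, |s| < δ → |t| < δ →
      ∫ ω, exp ((s * X ω + t * Y ω : ℝ) * I) ∂μ =
        (∫ ω, exp ((s * X ω : ℝ) * I) ∂μ) * ∫ ω, exp ((t * Y ω : ℝ) * I) ∂μ) (p : ℕ) :
    ∫⁻ ω, ENNReal.ofReal (|X ω| ^ (2 * p) * |Y ω| ^ (2 * p)) ∂μ ≤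
      (∫⁻ ω, ENNReal.ofReal (|X ω| ^ (2 * p)) ∂μ) *
        ∫⁻ ω, ENNReal.ofReal (|Y ω| ^ (2 * p)) ∂μ := by
  set a : ℕ → ℝ := fun n => ((n : ℝ) + 1)⁻¹ with ha
  have ha0 : ∀ n, 0 < a n := fun n => by rw [ha]; positivity
  have hatend : Tendsto a atTop (𝓝 0) := by
    simpa using tendsto_one_div_add_atTop_nhds_zero_nat (𝕜 := ℝ)
  have hlim : ∀ x : ℝ, Tendsto (fun n => expSubOnePow p (a n) x / a n ^ (2 * p)) atTop
      (𝓝 (|x| ^ (2 * p))) := by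
    intro x
    refine ((tendsto_norm_exp_sub_one_div x).pow (2 * p)).congr fun n => ?_
    rw [expSubOnePow, div_pow]
  have hev : ∀ᶠ n : ℕ in atTop, a n * p < δ := by
    have := hatend.mul_const (p : ℝ)
    rw [zero_mul] at this
    exact this.eventually (gt_mem_nhds hδ)
  set F : ℕ → Ω → ENNReal := fun n ω =>
    ENNReal.ofReal ((expSubOnePow p (a n) (X ω) / a n ^ (2 * p)) *
      (expSubOnePow p (a n) (Y ω) / a n ^ (2 * p))) with hF
  have hFm : ∀ n, Measurable (F n) := fun n =>
    ((((measurable_expSubOnePow _ _).comp hX).div_const _).mul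
      (((measurable_expSubOnePow _ _).comp hY).div_const _)).ennreal_ofReal
  have hFlim : ∀ ω, liminf (fun n => F n ω) atTop =
      ENNReal.ofReal (|X ω| ^ (2 * p) * |Y ω| ^ (2 * p)) := fun ω =>
    (ENNReal.tendsto_ofReal ((hlim (X ω)).mul (hlim (Y ω)))).liminf_eq
  -- The rescaled surrogates converge pointwise to the even powers and are dominated by them, so
  -- Fatou gives the inequality without any integrability assumption.
  have hfatou := lintegral_liminf_le (μ := μ) (u := atTop) hFm
  simp_rw [hFlim] at hfatou
  refine hfatou.trans ?_
  refine liminf_le_of_frequently_le' (Eventually.frequently ?_)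
  filter_upwards [hev] with n hn
  have hpos : 0 < a n ^ (2 * p) := pow_pos (ha0 n) _
  have hnn : ∀ x, 0 ≤ expSubOnePow p (a n) x / a n ^ (2 * p) := fun x =>
    div_nonneg (expSubOnePow_nonneg _ _ _) hpos.le
  have hZ : ∀ (Z : Ω → ℝ), Measurable Z →
      ENNReal.ofReal (∫ ω, expSubOnePow p (a n) (Z ω) / a n ^ (2 * p) ∂μ) ≤
        ∫⁻ ω, ENNReal.ofReal (|Z ω| ^ (2 * p)) ∂μ := by
    intro Z hZ
    rw [ofReal_integral_eq_lintegral_ofReal ((integrable_expSubOnePow p _ hZ).div_const _)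
      (ae_of_all _ fun ω => hnn _)]
    exact lintegral_mono fun ω => ENNReal.ofReal_le_ofReal (expSubOnePow_div_le p (ha0 n) _)
  have hint : Integrable (fun ω => (expSubOnePow p (a n) (X ω) / a n ^ (2 * p)) *
      (expSubOnePow p (a n) (Y ω) / a n ^ (2 * p))) μ := by
    refine ((integrable_expSubOnePow p (a n) hX).div_const _).mul_bdd
      (c := 2 ^ (2 * p) / a n ^ (2 * p))
      (((measurable_expSubOnePow _ _).comp hY).div_const _).aestronglyMeasurable
      (ae_of_all _ fun ω => ?_)
    rw [Real.norm_of_nonneg (hnn _)]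
    gcongr
    exact expSubOnePow_le _ _ _
  have heq : ∫⁻ ω, F n ω ∂μ =
      ENNReal.ofReal (∫ ω, expSubOnePow p (a n) (X ω) / a n ^ (2 * p) ∂μ) *
        ENNReal.ofReal (∫ ω, expSubOnePow p (a n) (Y ω) / a n ^ (2 * p) ∂μ) := by
    rw [hF, ← ofReal_integral_eq_lintegral_ofReal hint
      (ae_of_all _ fun ω => mul_nonneg (hnn _) (hnn _)),
      ← ENNReal.ofReal_mul (integral_nonneg fun ω => hnn _)]
    congr 1
    simp_rw [div_mul_div_comm]
    rw [integral_div, integral_div, integral_div,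
      integral_expSubOnePow_mul hX hY hfac p (ha0 n) hn, div_mul_div_comm]
  rw [heq]
  exact mul_le_mul' (hZ X hX) (hZ Y hY)

/-- If `X` is independent of `(A, B)` and `(a X + A)(b X + B)` is in `L^m`, then `X` is in
`L^(2m)`. -/
theorem lintegral_pow_lt_top_of_mixed_moment {X A B : Ω → ℝ} (hX : Measurable X)
    (hA : Measurable A) (hB : Measurable B) (hind : IndepFun X (fun ω => (A ω, B ω)) μ) {a b : ℝ}
    (ha : a ≠ 0) (hb : b ≠ 0) (m : ℕ)
    (h : ∫⁻ ω, ENNReal.ofReal (|a * X ω + A ω| ^ m * |b * X ω + B ω| ^ m) ∂μ < ⊤) :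
    ∫⁻ ω, ENNReal.ofReal (|X ω| ^ (2 * m)) ∂μ < ⊤ := by
  have hAB : Measurable fun ω => (A ω, B ω) := hA.prodMk hB
  set G : (ℝ × ℝ) × ℝ → ENNReal := fun q =>
    ENNReal.ofReal (|a * q.2 + q.1.1| ^ m * |b * q.2 + q.1.2| ^ m) with hG
  have hGm : Measurable G := by rw [hG]; fun_prop
  have hmap := (indepFun_iff_map_prod_eq_prod_map_map hAB.aemeasurable hX.aemeasurable).1 hind.symm
  have h1 : ∫⁻ q, G q ∂((μ.map fun ω => (A ω, B ω)).prod (μ.map X)) < ⊤ := by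
    rw [← hmap, lintegral_map hGm (hAB.prodMk hX)]
    exact h
  rw [lintegral_prod _ hGm.aemeasurable] at h1
  have h2 := ae_lt_top (hGm.lintegral_prod_right') h1.ne
  have : IsProbabilityMeasure (μ.map fun ω => (A ω, B ω)) :=
    Measure.isProbabilityMeasure_map hAB.aemeasurable
  have : IsProbabilityMeasure (μ.map X) := Measure.isProbabilityMeasure_map hX.aemeasurable
  -- By Fubini the integral over `X` alone is finite for almost every value of `(A, B)`; one such
  -- value suffices.
  obtain ⟨⟨α, β⟩, hαβ⟩ := h2.exists
  have h3 : ∫⁻ x : ℝ, ENNReal.ofReal (|x| ^ (2 * m)) ∂(μ.map X) < ⊤ := by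
    -- Beyond `R` the constant in each linear factor is at most half of the linear term, so both
    -- factors are bounded below by a multiple of `|x|`.
    set R : ℝ := 2 * (|α| / |a| + |β| / |b|) with hR
    have hR0 : 0 ≤ R := by positivity
    have ha' : 0 < |a| := abs_pos.2 ha
    have hb' : 0 < |b| := abs_pos.2 hb
    have hlin : ∀ c γ x : ℝ, 0 < |c| → 2 * (|γ| / |c|) ≤ |x| → |x| ≤ 2 / |c| * |c * x + γ| := by
      intro c γ x hc hx
      have h4 : |c| * |x| ≤ |c * x + γ| + |γ| := by
        rw [← abs_mul]
        calc |c * x| = |(c * x + γ) - γ| := by ring_nf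
          _ ≤ _ := abs_sub _ _
      have h5 : 2 * |γ| ≤ |c| * |x| := by
        calc 2 * |γ| = |c| * (2 * (|γ| / |c|)) := by field_simp
          _ ≤ _ := by gcongr
      rw [div_mul_eq_mul_div, le_div_iff₀ hc]
      linarith
    have hbd : ∀ x : ℝ, |x| ^ (2 * m) ≤
        R ^ (2 * m) + (2 / |a| * (2 / |b|)) ^ m * (|a * x + α| ^ m * |b * x + β| ^ m) := by
      intro x
      rcases le_total |x| R with hx | hx
      · have := pow_le_pow_left₀ (abs_nonneg x) hx (2 * m)
        have : 0 ≤ (2 / |a| * (2 / |b|)) ^ m * (|a * x + α| ^ m * |b * x + β| ^ m) := by positivity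
        linarith
      · have e1 := hlin a α x ha' (by
          have : 0 ≤ |β| / |b| := by positivity
          linarith)
        have e2 := hlin b β x hb' (by
          have : 0 ≤ |α| / |a| := by positivity
          linarith)
        have : |x| ^ (2 * m) ≤
            (2 / |a| * (2 / |b|)) ^ m * (|a * x + α| ^ m * |b * x + β| ^ m) := by
          calc |x| ^ (2 * m) = (|x| * |x|) ^ m := by rw [pow_mul, sq]
            _ ≤ (2 / |a| * |a * x + α| * (2 / |b| * |b * x + β|)) ^ m := by gcongr
            _ = _ := by rw [← mul_pow, ← mul_pow]; ring
        have : 0 ≤ R ^ (2 * m) := by positivity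
        linarith
    have hK : 0 ≤ (2 / |a| * (2 / |b|)) ^ m := by positivity
    calc ∫⁻ x : ℝ, ENNReal.ofReal (|x| ^ (2 * m)) ∂(μ.map X)
        ≤ ∫⁻ x : ℝ, (ENNReal.ofReal (R ^ (2 * m)) + ENNReal.ofReal ((2 / |a| * (2 / |b|)) ^ m) *
            G ((α, β), x)) ∂(μ.map X) := by
          refine lintegral_mono fun x => ?_
          rw [hG]
          simp only
          rw [← ENNReal.ofReal_mul hK, ← ENNReal.ofReal_add (by positivity) (by positivity)]
          exact ENNReal.ofReal_le_ofReal (hbd x)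
      _ < ⊤ := by
          rw [lintegral_add_left measurable_const, lintegral_const_mul _ (by fun_prop)]
          simp only [lintegral_const, measure_univ, mul_one]
          exact ENNReal.add_lt_top.2 ⟨ENNReal.ofReal_lt_top,
            ENNReal.mul_lt_top ENNReal.ofReal_lt_top hαβ⟩
  rwa [lintegral_map (by fun_prop) hX] at h3

end MixedMoments

/-! ### Independent linear forms: factorization and moments. -/

section LinearForms

open Complex Filter Topology

variable {Ω ι : Type*} [MeasurableSpace Ω] {μ : Measure Ω} {ε : ι → Ω → ℝ}

/-- Families of linear combinations of independent variables with disjoint supports are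
independent. -/
theorem indepFun_linear_family (hind : iIndepFun ε μ) (hm : ∀ i, Measurable (ε i))
    {S T : Finset ι} (hST : Disjoint S T) {κ : Type*} (c : ι → ℝ) (d : κ → ι → ℝ) :
    IndepFun (fun ω => ∑ i ∈ S, c i * ε i ω) (fun ω k => ∑ i ∈ T, d k i * ε i ω) μ := by
  have h := hind.indepFun_finset S T hST hm
  have hφ : Measurable fun x : S → ℝ => ∑ i : S, c i * x i := by fun_prop
  have hψ : Measurable fun (x : T → ℝ) (k : κ) => ∑ i : T, d k i * x i := by fun_prop
  have := h.comp hφ hψ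
  convert! this using 1
  · funext ω
    exact (Finset.sum_coe_sort S fun i => c i * ε i ω).symm
  · funext ω k
    exact (Finset.sum_coe_sort T fun i => d k i * ε i ω).symm

theorem indepFun_linear (hind : iIndepFun ε μ) (hm : ∀ i, Measurable (ε i))
    {S T : Finset ι} (hST : Disjoint S T) (c d : ι → ℝ) :
    IndepFun (fun ω => ∑ i ∈ S, c i * ε i ω) (fun ω => ∑ i ∈ T, d i * ε i ω) μ :=
  (indepFun_linear_family hind hm hST c (fun _ : Unit => d)).comp measurable_id
    (measurable_pi_apply ())

theorem indepFun_linear_prodMk (hind : iIndepFun ε μ) (hm : ∀ i, Measurable (ε i))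
    {S T : Finset ι} (hST : Disjoint S T) (c d e : ι → ℝ) :
    IndepFun (fun ω => ∑ i ∈ S, c i * ε i ω)
      (fun ω => (∑ i ∈ T, d i * ε i ω, ∑ i ∈ T, e i * ε i ω)) μ :=
  (indepFun_linear_family hind hm hST c (fun b : Bool => bif b then d else e)).comp measurable_id
    ((measurable_pi_apply true).prodMk (measurable_pi_apply false))

theorem memLp_nat_iff_lintegral {Z : Ω → ℝ} (hZ : Measurable Z) {p : ℕ} (hp : p ≠ 0) :
    MemLp Z p μ ↔ ∫⁻ ω, ENNReal.ofReal (|Z ω| ^ p) ∂μ < ⊤ := by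
  have h1 : ∀ ω, ENNReal.ofReal (|Z ω| ^ p) = ‖Z ω‖ₑ ^ p := fun ω => by
    rw [ENNReal.ofReal_pow (abs_nonneg _), ← Real.enorm_eq_ofReal_abs]
  simp_rw [h1]
  rw [MemLp, and_iff_right hZ.aestronglyMeasurable,
    eLpNorm_lt_top_iff_lintegral_rpow_enorm_lt_top (by exact_mod_cast hp) (by simp)]
  simp

variable [IsProbabilityMeasure μ]

theorem integral_exp_linear [Fintype ι] (hind : iIndepFun ε μ) (hm : ∀ i, Measurable (ε i))
    (S : Finset ι) (c : ι → ℝ) :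
    ∫ ω, exp ((∑ i ∈ S, c i * ε i ω : ℝ) * I) ∂μ = ∏ i ∈ S, charFun (μ.map (ε i)) (c i) := by
  classical
  have hfi : ∀ i, Measurable fun x : ℝ => if i ∈ S then exp ((c i : ℂ) * x * I) else 1 := by
    intro i
    split_ifs <;> fun_prop
  have h := hind.integral_fun_prod_comp
    (f := fun i (x : ℝ) => if i ∈ S then exp ((c i : ℂ) * x * I) else 1)
    (fun i => (hm i).aemeasurable) (fun i => (hfi i).aestronglyMeasurable)
  have e : ∀ ω, ∏ i, (if i ∈ S then exp ((c i : ℂ) * (ε i ω : ℝ) * I) else 1) =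
      exp ((∑ i ∈ S, c i * ε i ω : ℝ) * I) := by
    intro ω
    rw [Finset.prod_ite_mem, Finset.univ_inter, ← exp_sum]
    congr 1
    push_cast
    rw [Finset.sum_mul]
  simp_rw [e] at h
  have h1 : ∀ i, ∫ ω, (if i ∈ S then exp ((c i : ℂ) * (ε i ω : ℝ) * I) else 1) ∂μ =
      if i ∈ S then charFun (μ.map (ε i)) (c i) else 1 := by
    intro i
    split_ifs
    · rw [charFun_apply_real, integral_map (hm i).aemeasurable (by fun_prop)]
    · simp
  rw [h]
  simp_rw [h1]
  rw [Finset.prod_ite_mem, Finset.univ_inter]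

variable [Fintype ι]

theorem prod_charFun_eq_of_indepFun (hind : iIndepFun ε μ) (hm : ∀ i, Measurable (ε i))
    {a b : ι → ℝ} (h : IndepFun (fun ω => ∑ i, a i * ε i ω) (fun ω => ∑ i, b i * ε i ω) μ)
    (s t : ℝ) :
    ∏ i, charFun (μ.map (ε i)) (s * a i + t * b i) =
      (∏ i, charFun (μ.map (ε i)) (s * a i)) * ∏ i, charFun (μ.map (ε i)) (t * b i) := by
  rw [← integral_exp_linear hind hm, ← integral_exp_linear hind hm, ← integral_exp_linear hind hm]
  have := h.integral_fun_comp_mul_comp (f := fun x : ℝ => exp ((s * x : ℝ) * I))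
    (g := fun x : ℝ => exp ((t * x : ℝ) * I)) (by fun_prop) (by fun_prop) (by fun_prop)
    (by fun_prop)
  simp only [Finset.mul_sum] at this
  simp_rw [mul_assoc]
  rw [← this]
  refine integral_congr_ae (ae_of_all _ fun ω => ?_)
  simp only
  rw [← exp_add, ← add_mul, ← ofReal_add, ← Finset.sum_add_distrib]
  congr 5
  funext i
  ring

/-- Near the origin, the characteristic functions of the variables that occur in both of two
independent linear forms satisfy the factorization equation of independent linear forms. -/
theorem exists_prod_charFun_eq_of_indepFun (hind : iIndepFun ε μ) (hm : ∀ i, Measurable (ε i))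
    {a b : ι → ℝ} (h : IndepFun (fun ω => ∑ i, a i * ε i ω) (fun ω => ∑ i, b i * ε i ω) μ)
    {S : Finset ι} (hS : ∀ i, i ∈ S ↔ a i * b i ≠ 0) :
    ∃ δ > 0, ∀ s t : ℝ, |s| < δ → |t| < δ →
      ∏ i ∈ S, charFun (μ.map (ε i)) (s * a i + t * b i) =
        (∏ i ∈ S, charFun (μ.map (ε i)) (s * a i)) *
          ∏ i ∈ S, charFun (μ.map (ε i)) (t * b i) := by
  classical
  have hprob : ∀ i, IsProbabilityMeasure (μ.map (ε i)) := fun i =>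
    Measure.isProbabilityMeasure_map (hm i).aemeasurable
  have hev : ∀ c : ι → ℝ, ∀ᶠ s in 𝓝 (0 : ℝ), ∀ i, charFun (μ.map (ε i)) (s * c i) ≠ 0 := by
    intro c
    refine eventually_all.2 fun i => ?_
    have : Tendsto (fun s : ℝ => s * c i) (𝓝 0) (𝓝 0) := by
      have : Continuous fun s : ℝ => s * c i := by fun_prop
      simpa using this.tendsto 0
    exact this.eventually eventually_charFun_ne_zero
  obtain ⟨δ, hδ, hδ'⟩ := Metric.eventually_nhds_iff.1 ((hev a).and (hev b))
  refine ⟨δ, hδ, fun s t hs ht => ?_⟩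
  have hs' := (hδ' (by simpa using hs : dist s 0 < δ)).1
  have ht' := (hδ' (by simpa using ht : dist t 0 < δ)).2
  have key := prod_charFun_eq_of_indepFun hind hm h s t
  rw [← Finset.prod_mul_prod_compl S, ← Finset.prod_mul_prod_compl S, ← Finset.prod_mul_prod_compl S]
    at key
  -- A variable outside `S` has a zero coefficient in one of the forms, so its factor is the same on
  -- both sides. It cancels because characteristic functions do not vanish near 0.
  have hc : ∏ i ∈ Sᶜ, charFun (μ.map (ε i)) (s * a i + t * b i) =
      (∏ i ∈ Sᶜ, charFun (μ.map (ε i)) (s * a i)) *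
        ∏ i ∈ Sᶜ, charFun (μ.map (ε i)) (t * b i) := by
    rw [← Finset.prod_mul_distrib]
    refine Finset.prod_congr rfl fun i hi => ?_
    have hi' : a i * b i = 0 := by
      by_contra h0
      exact Finset.mem_compl.1 hi ((hS i).2 h0)
    rcases mul_eq_zero.1 hi' with h0 | h0 <;> simp [h0]
  rw [hc] at key
  have hne : (∏ i ∈ Sᶜ, charFun (μ.map (ε i)) (s * a i)) *
        ∏ i ∈ Sᶜ, charFun (μ.map (ε i)) (t * b i) ≠ 0 :=
    mul_ne_zero (Finset.prod_ne_zero_iff.2 fun i _ => hs' i)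
      (Finset.prod_ne_zero_iff.2 fun i _ => ht' i)
  refine mul_right_cancel₀ hne (key.trans ?_)
  ring

/-- Square-integrable independent variables that occur in both of two independent linear forms have
moments of all orders. -/
theorem memLp_of_indepFun_linear (hind : iIndepFun ε μ) (hm : ∀ i, Measurable (ε i))
    (hL2 : ∀ i, MemLp (ε i) 2 μ) {a b : ι → ℝ}
    (h : IndepFun (fun ω => ∑ i, a i * ε i ω) (fun ω => ∑ i, b i * ε i ω) μ) {i : ι}
    (hi : a i * b i ≠ 0) (n : ℕ) : MemLp (ε i) n μ := by
  classical
  set S : Finset ι := Finset.univ.filter fun i => a i * b i ≠ 0 with hSdef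
  have hS : ∀ i, i ∈ S ↔ a i * b i ≠ 0 := by simp [hSdef]
  obtain ⟨δ, hδ, hfac⟩ := exists_prod_charFun_eq_of_indepFun hind hm h hS
  have hlin : ∀ c : ι → ℝ, Measurable fun ω => ∑ i ∈ S, c i * ε i ω := fun c => by fun_prop
  have hfac' : ∀ s t : ℝ, |s| < δ → |t| < δ →
      ∫ ω, exp ((s * (∑ i ∈ S, a i * ε i ω) + t * ∑ i ∈ S, b i * ε i ω : ℝ) * I) ∂μ =
        (∫ ω, exp ((s * ∑ i ∈ S, a i * ε i ω : ℝ) * I) ∂μ) *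
          ∫ ω, exp ((t * ∑ i ∈ S, b i * ε i ω : ℝ) * I) ∂μ := by
    intro s t hs ht
    have := hfac s t hs ht
    rw [← integral_exp_linear hind hm, ← integral_exp_linear hind hm,
      ← integral_exp_linear hind hm] at this
    simpa only [add_mul, Finset.sum_add_distrib, mul_assoc, ← Finset.mul_sum] using this
  -- Bootstrapping by doubling, from `L²`: if both forms are in `L^(2^(n+1))`, so is their product,
  -- and a variable present in both then lies in `L^(2^(n+2))`.
  have key : ∀ n : ℕ, ∀ i ∈ S, MemLp (ε i) (2 ^ (n + 1) : ℕ) μ := by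
    intro n
    induction n with
    | zero => intro i _; simpa using hL2 i
    | succ n ih =>
      intro i hi
      have hmem : ∀ c : ι → ℝ, MemLp (fun ω => ∑ i ∈ S, c i * ε i ω) (2 ^ (n + 1) : ℕ) μ :=
        fun c => memLp_finsetSum S fun i hi => (ih i hi).const_mul (c i)
      have hfin : ∀ c : ι → ℝ,
          ∫⁻ ω, ENNReal.ofReal (|∑ i ∈ S, c i * ε i ω| ^ (2 * 2 ^ n)) ∂μ < ⊤ := fun c => by
        have := (memLp_nat_iff_lintegral (hlin c) (by positivity)).1 (hmem c)
        rwa [pow_succ'] at this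
      have hmix := (lintegral_mixed_moment_le (hlin a) (hlin b) hδ hfac' (2 ^ n)).trans_lt
        (ENNReal.mul_lt_top (hfin a) (hfin b))
      have hsplit : ∀ (c : ι → ℝ) ω, ∑ i ∈ S, c i * ε i ω =
          c i * ε i ω + ∑ i ∈ S.erase i, c i * ε i ω := fun c ω =>
        (Finset.add_sum_erase S (fun i => c i * ε i ω) hi).symm
      simp_rw [hsplit] at hmix
      have hindep : IndepFun (ε i)
          (fun ω => (∑ i ∈ S.erase i, a i * ε i ω, ∑ i ∈ S.erase i, b i * ε i ω)) μ := by
        have := indepFun_linear_prodMk hind hm (S := {i}) (T := S.erase i) (by simp) 1 a b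
        simpa using this
      have hab := mul_ne_zero_iff.1 ((hS i).1 hi)
      have := lintegral_pow_lt_top_of_mixed_moment (hm i)
        (by fun_prop : Measurable fun ω => ∑ i ∈ S.erase i, a i * ε i ω)
        (by fun_prop : Measurable fun ω => ∑ i ∈ S.erase i, b i * ε i ω) hindep hab.1 hab.2 _ hmix
      rw [memLp_nat_iff_lintegral (hm i) (by positivity)]
      rwa [← pow_succ', ← pow_succ'] at this
  refine (key n i ((hS i).2 hi)).mono_exponent ?_
  have : n ≤ 2 ^ (n + 1) := (Nat.lt_two_pow_self.le.trans (Nat.pow_le_pow_right (by norm_num)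
    (Nat.le_succ n)))
  exact_mod_cast this

end LinearForms

/-! ### Additivity of cumulants and separation of coefficient ratios. -/

section Cumulants

open Complex Filter Topology Polynomial

theorem iteratedDeriv_comp_mul_left' (c : ℝ) (f : ℝ → ℂ) (n : ℕ) :
    iteratedDeriv n (fun s => f (c * s)) = fun s => c ^ n • iteratedDeriv n f (c * s) := by
  induction n with
  | zero => simp
  | succ n ih =>
    rw [iteratedDeriv_succ, ih]
    funext s
    have h := deriv_const_smul_field (x := s) (c ^ n) (fun s => iteratedDeriv n f (c * s))
    refine h.trans ?_
    rw [deriv_comp_mul_left, iteratedDeriv_succ, smul_smul, pow_succ]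

theorem logDeriv_comp_mul_left (c : ℝ) (f : ℝ → ℂ) :
    logDeriv (fun s => f (c * s)) = fun s => (c : ℂ) * logDeriv f (c * s) := by
  funext s
  rw [logDeriv_apply, deriv_comp_mul_left, logDeriv_apply, real_smul, mul_div_assoc]

/-- Additivity and homogeneity of cumulants. -/
theorem iteratedDeriv_logDeriv_prod_charFun {κ : Type*} (T : Finset κ) (ν : κ → Measure ℝ)
    [∀ k, IsProbabilityMeasure (ν k)] (hmom : ∀ k ∈ T, ∀ n : ℕ, MemLp id n (ν k)) (c : κ → ℝ)
    (n : ℕ) :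
    iteratedDeriv n (logDeriv fun s : ℝ => ∏ k ∈ T, charFun (ν k) (c k * s)) 0 =
      ∑ k ∈ T, (c k : ℂ) ^ (n + 1) * iteratedDeriv n (logDeriv (charFun (ν k))) 0 := by
  have htend : ∀ k, Tendsto (fun s : ℝ => c k * s) (𝓝 0) (𝓝 0) := fun k => by
    have : Continuous fun s : ℝ => c k * s := by fun_prop
    simpa using this.tendsto 0
  have hev : (logDeriv fun s : ℝ => ∏ k ∈ T, charFun (ν k) (c k * s)) =ᶠ[𝓝 0]
      fun s => ∑ k ∈ T, (c k : ℂ) * logDeriv (charFun (ν k)) (c k * s) := by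
    have hne : ∀ᶠ s in 𝓝 (0 : ℝ), ∀ k ∈ T, charFun (ν k) (c k * s) ≠ 0 :=
      (Finset.eventually_all T).2 fun k _ =>
        (htend k).eventually (eventually_charFun_ne_zero (ν := ν k))
    filter_upwards [hne] with s hs
    rw [logDeriv_prod (fun k hk => hs k hk)]
    · simp_rw [logDeriv_comp_mul_left]
    · intro k hk
      have : Differentiable ℝ (charFun (ν k)) :=
        (contDiff_charFun_of_moments (hmom k hk) 1).differentiable (by simp)
      fun_prop
  rw [hev.iteratedDeriv_eq, iteratedDeriv_fun_sum]
  · refine Finset.sum_congr rfl fun k _ => ?_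
    rw [iteratedDeriv_const_mul_field, iteratedDeriv_comp_mul_left' (c k)]
    simp only [mul_zero, real_smul, ofReal_pow]
    ring
  · intro k hk
    refine contDiffAt_const.mul ?_
    have h1 := contDiffAt_logDeriv_charFun (hmom k hk) n
    refine ContDiffAt.comp (0 : ℝ) (g := logDeriv (charFun (ν k))) (f := fun s => c k * s) ?_
      (by fun_prop)
    simpa using h1

/-- An identity for all real `x` is an identity of polynomials. The right side contributes only in
degrees 0 and `N`, so the mixed coefficients vanish. -/
theorem sum_mul_pow_mul_pow_eq_zero {ι : Type*} (S : Finset ι) (κ : ι → ℂ) (a b : ι → ℂ) (N : ℕ)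
    (h : ∀ x : ℝ, ∑ i ∈ S, (a i + x * b i) ^ N * κ i =
      ∑ i ∈ S, a i ^ N * κ i + ∑ i ∈ S, (x * b i) ^ N * κ i) {q : ℕ} (hq0 : 0 < q) (hqN : q < N) :
    ∑ i ∈ S, κ i * (a i ^ (N - q) * b i ^ q) = 0 := by
  set p : ℂ[X] := (∑ m ∈ Finset.range (N + 1),
    Polynomial.C (∑ i ∈ S, κ i * (a i ^ (N - m) * b i ^ m) * N.choose m) * X ^ m) -
    Polynomial.C (∑ i ∈ S, a i ^ N * κ i) -
    Polynomial.C (∑ i ∈ S, b i ^ N * κ i) * X ^ N with hp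
  have hp0 : p = 0 := by
    refine Polynomial.eq_zero_of_infinite_isRoot p ?_
    refine (Set.infinite_range_of_injective ofReal_injective).mono ?_
    rintro _ ⟨x, rfl⟩
    have hx := h x
    have e1 : ∑ i ∈ S, (a i + x * b i) ^ N * κ i = ∑ m ∈ Finset.range (N + 1),
        (∑ i ∈ S, κ i * (a i ^ (N - m) * b i ^ m) * N.choose m) * (x : ℂ) ^ m := by
      simp_rw [Finset.sum_mul]
      rw [Finset.sum_comm]
      refine Finset.sum_congr rfl fun i _ => ?_
      rw [add_comm, add_pow, Finset.sum_mul]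
      refine Finset.sum_congr rfl fun m _ => ?_
      rw [mul_pow]
      ring
    have e2 : ∑ i ∈ S, (x * b i) ^ N * κ i = (∑ i ∈ S, b i ^ N * κ i) * (x : ℂ) ^ N := by
      rw [Finset.sum_mul]
      refine Finset.sum_congr rfl fun i _ => ?_
      rw [mul_pow]
      ring
    rw [e1, e2] at hx
    simp only [Set.mem_ofPred_eq, IsRoot, hp, eval_sub, eval_finsetSum, eval_mul, eval_C, eval_pow,
      eval_X]
    rw [hx]
    ring
  have hcoeff : p.coeff q = (∑ i ∈ S, κ i * (a i ^ (N - q) * b i ^ q)) * N.choose q := by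
    rw [hp]
    simp only [coeff_sub, finsetSum_coeff, coeff_C_mul, coeff_X_pow, mul_ite, mul_one, mul_zero,
      coeff_C, hq0.ne', hqN.ne, if_false, sub_zero]
    rw [Finset.sum_ite_eq, if_pos (by simp; omega), Finset.sum_mul]
  rw [hp0, coeff_zero] at hcoeff
  have hch : (N.choose q : ℂ) ≠ 0 := by exact_mod_cast (Nat.choose_pos hqN.le).ne'
  exact (mul_eq_zero.1 hcoeff.symm).resolve_right hch

/-- Vandermonde-type separation of the classes of proportional pairs `(a i, b i)`. -/
theorem sum_filter_ratio_eq_zero {ι : Type*} [DecidableEq ι] (S : Finset ι) (κ : ι → ℂ)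
    (a b : ι → ℝ) (hab : ∀ i ∈ S, a i * b i ≠ 0) (N : ℕ) (hN : S.card < N)
    (h : ∀ q, 0 < q → q < N → ∑ i ∈ S, κ i * ((a i : ℂ) ^ (N - q) * (b i : ℂ) ^ q) = 0)
    {i₀ : ι} (hi₀ : i₀ ∈ S) :
    ∑ i ∈ S with b i / a i = b i₀ / a i₀, (a i : ℂ) ^ N * κ i = 0 := by
  set r : ι → ℝ := fun i => b i / a i with hr
  -- Among the ratios, `w` vanishes at all but that of `i₀`. The factor `X` removes the coefficient
  -- of degree 0 and the degree stays below `N`, so only the mixed relations `0 < q < N` are needed.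
  set w : ℝ[X] := X * ∏ ρ ∈ (S.image r).erase (r i₀), (X - Polynomial.C ρ) with hw
  have hdeg : w.natDegree ≤ S.card := by
    have h1 : w.natDegree = 1 + ((S.image r).erase (r i₀)).card := by
      rw [hw, Monic.natDegree_mul monic_X (monic_prod_X_sub_C _ _), natDegree_X,
        natDegree_finsetProd_X_sub_C_eq_card]
    rw [h1, Finset.card_erase_of_mem (Finset.mem_image_of_mem r hi₀)]
    have := Finset.card_image_le (s := S) (f := r)
    have : 0 < (S.image r).card := Finset.card_pos.2 ⟨_, Finset.mem_image_of_mem r hi₀⟩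
    omega
  have hcoeff0 : w.coeff 0 = 0 := by rw [hw]; simp
  have hrest : ∀ i ∈ S, r i ≠ r i₀ → w.eval (r i) = 0 := by
    intro i hi hne
    rw [hw, eval_mul, eval_prod, Finset.prod_eq_zero (i := r i)]
    · simp
    · exact Finset.mem_erase.2 ⟨hne, Finset.mem_image_of_mem r hi⟩
    · simp
  have hw0 : w.eval (r i₀) ≠ 0 := by
    rw [hw, eval_mul, eval_prod, eval_X]
    refine mul_ne_zero ?_ (Finset.prod_ne_zero_iff.2 fun ρ hρ => ?_)
    · have := mul_ne_zero_iff.1 (hab i₀ hi₀)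
      exact div_ne_zero this.2 this.1
    · rw [eval_sub, eval_X, eval_C]
      exact sub_ne_zero.2 (Finset.ne_of_mem_erase hρ).symm
  have hsum : ∑ i ∈ S, (a i : ℂ) ^ N * κ i * ((w.eval (r i) : ℝ) : ℂ) = 0 := by
    simp_rw [eval_eq_sum_range, ofReal_sum, Finset.mul_sum]
    rw [Finset.sum_comm]
    refine Finset.sum_eq_zero fun q hq => ?_
    have hqN : q < N := by
      have := Finset.mem_range.1 hq
      omega
    rcases Nat.eq_zero_or_pos q with rfl | hq0
    · simp [hcoeff0]
    · have := congrArg (fun z => (w.coeff q : ℂ) * z) (h q hq0 hqN)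
      simp only [mul_zero, Finset.mul_sum] at this
      rw [← this]
      refine Finset.sum_congr rfl fun i hi => ?_
      have ha : (a i : ℂ) ≠ 0 := by exact_mod_cast (mul_ne_zero_iff.1 (hab i hi)).1
      have hpow : (a i : ℂ) ^ N = (a i : ℂ) ^ (N - q) * (a i : ℂ) ^ q := by
        rw [← pow_add]; congr 1; omega
      rw [hpow, hr]
      push_cast
      rw [div_pow]
      field_simp
  have hsplit : ∑ i ∈ S, (a i : ℂ) ^ N * κ i * ((w.eval (r i) : ℝ) : ℂ) =
      (∑ i ∈ S with r i = r i₀, (a i : ℂ) ^ N * κ i) * ((w.eval (r i₀) : ℝ) : ℂ) := by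
    rw [Finset.sum_mul, Finset.sum_filter]
    refine Finset.sum_congr rfl fun i hi => ?_
    split_ifs with hri
    · rw [hri]
    · rw [hrest i hi hri]; simp
  rw [hsplit] at hsum
  exact (mul_eq_zero.1 hsum).resolve_right (by exact_mod_cast hw0)

end Cumulants

/-! ### The Darmois–Skitovich theorem. -/

section DarmoisSkitovich

open Complex Filter Topology Polynomial

variable {Ω ι : Type*} [MeasurableSpace Ω] {μ : Measure Ω} [IsProbabilityMeasure μ]
  {ε : ι → Ω → ℝ}

/-- A lower bound for the moment generating function by Jensen's inequality. -/
theorem exp_mul_integral_le_mgf {T : Ω → ℝ} (hT : Integrable T μ) {x : ℝ}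
    (hint : Integrable (fun ω => Real.exp (x * T ω)) μ) :
    Real.exp (x * ∫ ω, T ω ∂μ) ≤ mgf T μ x := by
  set m := ∫ ω, T ω ∂μ with hm
  have hi : Integrable (fun ω => x * (T ω - m)) μ := (hT.sub (integrable_const m)).const_mul x
  have h1 : ∫ ω, Real.exp (x * m) * (1 + x * (T ω - m)) ∂μ ≤ mgf T μ x := by
    refine integral_mono ?_ hint fun ω => ?_
    · exact ((integrable_const 1).add hi).const_mul _
    · have := Real.add_one_le_exp (x * (T ω - m))
      have h2 : Real.exp (x * T ω) = Real.exp (x * m) * Real.exp (x * (T ω - m)) := by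
        rw [← Real.exp_add]; ring_nf
      simp only
      rw [h2]
      gcongr
      linarith
  refine le_trans (le_of_eq ?_) h1
  rw [integral_const_mul, integral_add (integrable_const _) hi, integral_const_mul,
    integral_sub hT (integrable_const m)]
  simp [hm]

theorem norm_eval_le_mul_pow (P : ℂ[X]) :
    ∃ K : ℝ, 0 ≤ K ∧ ∀ z : ℂ, ‖P.eval z‖ ≤ K * (1 + ‖z‖) ^ P.natDegree := by
  refine ⟨∑ i ∈ Finset.range (P.natDegree + 1), ‖P.coeff i‖, by positivity, fun z => ?_⟩
  rw [eval_eq_sum_range, Finset.sum_mul]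
  refine (norm_sum_le _ _).trans (Finset.sum_le_sum fun i hi => ?_)
  rw [norm_mul, norm_pow]
  gcongr
  calc ‖z‖ ^ i ≤ (1 + ‖z‖) ^ i := by gcongr; linarith [norm_nonneg z]
    _ ≤ _ := pow_le_pow_right₀ (by linarith [norm_nonneg z])
      (Nat.lt_succ_iff.1 (Finset.mem_range.1 hi))

/-- If the sum of two independent variables has all moments and only finitely many nonzero
cumulants, then the summands are Gaussian. -/
theorem exists_map_eq_gaussianReal_of_indepFun_add {Y T : Ω → ℝ} (hY : Measurable Y)
    (hT : Measurable T) (hind : IndepFun Y T μ) (hTi : Integrable T μ)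
    (hmom : ∀ n : ℕ, MemLp (fun ω => Y ω + T ω) n μ) {N : ℕ}
    (hN : ∀ n, N ≤ n →
      iteratedDeriv n (logDeriv (charFun (μ.map fun ω => Y ω + T ω))) 0 = 0) :
    ∃ m v, μ.map Y = gaussianReal m v := by
  have hW : Measurable fun ω => Y ω + T ω := hY.add hT
  have hpW : IsProbabilityMeasure (μ.map fun ω => Y ω + T ω) :=
    Measure.isProbabilityMeasure_map hW.aemeasurable
  have hpY : IsProbabilityMeasure (μ.map Y) := Measure.isProbabilityMeasure_map hY.aemeasurable
  have hmom' : ∀ n : ℕ, MemLp id n (μ.map fun ω => Y ω + T ω) := fun n =>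
    (memLp_map_measure_iff (by fun_prop) hW.aemeasurable).2 (hmom n)
  obtain ⟨P, hP⟩ := exists_polynomial_moments_eq hmom' hN
  have hE : Differentiable ℂ fun z => exp (P.eval z) := P.differentiable.cexp
  have hintW : ∀ t : ℝ, Integrable (fun ω => Real.exp (t * (Y ω + T ω))) μ := fun t =>
    (integrable_map_measure (by fun_prop) hW.aemeasurable).1
      (integrable_exp_of_moments_eq hmom' hE hP t)
  have hmgf : complexMGF (fun ω => Y ω + T ω) μ = fun z => exp (P.eval z) := by
    rw [← complexMGF_id_map hW.aemeasurable]
    exact complexMGF_eq_of_moments_eq hmom' hE hP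
  have hne : ∀ (Z : Ω → ℝ) (t : ℝ), ¬ (fun ω => Real.exp (t * Z ω)) =ᵐ[μ] 0 := by
    intro Z t h0
    obtain ⟨ω, hω⟩ := h0.exists
    exact (Real.exp_pos _).ne' hω
  have hexpind : ∀ t : ℝ,
      IndepFun (fun ω => Real.exp (t * Y ω)) (fun ω => Real.exp (t * T ω)) μ := fun t =>
    hind.exp_mul t t
  have hprodint : ∀ t : ℝ,
      Integrable (fun ω => Real.exp (t * Y ω) * Real.exp (t * T ω)) μ := fun t => by
    simpa only [mul_add, Real.exp_add] using hintW t
  -- For independent factors that are not almost surely zero, integrability of the product passes to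
  -- each factor.
  have hintY : ∀ t : ℝ, Integrable (fun ω => Real.exp (t * Y ω)) μ := fun t =>
    (hexpind t).integrable_left_of_integrable_op (fun x y => x * y) 1 one_ne_zero
      (fun x y => by simp [enorm_mul]) (hprodint t) (by fun_prop) (by fun_prop) (hne T t)
  have hintT : ∀ t : ℝ, Integrable (fun ω => Real.exp (t * T ω)) μ := fun t =>
    (hexpind t).integrable_right_of_integrable_op (fun x y => x * y) 1 one_ne_zero
      (fun x y => by simp [enorm_mul]) (hprodint t) (by fun_prop) (by fun_prop) (hne Y t)
  have hmul : ∀ z : ℂ, complexMGF Y μ z * complexMGF T μ z = exp (P.eval z) := by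
    intro z
    rw [← congrFun hmgf z]
    have := hind.integral_fun_comp_mul_comp (f := fun x : ℝ => exp (z * x))
      (g := fun x : ℝ => exp (z * x)) hY.aemeasurable hT.aemeasurable (by fun_prop) (by fun_prop)
    simp only [complexMGF]
    rw [← this]
    refine integral_congr_ae (ae_of_all _ fun ω => ?_)
    simp only
    rw [← exp_add]
    push_cast
    ring_nf
  obtain ⟨K, hK0, hK⟩ := norm_eval_le_mul_pow P
  set m := ∫ ω, T ω ∂μ with hm
  -- The product of the two generating functions is `exp P`, hence neither has a zero. Jensen bounds
  -- that of `T` below by `exp (x * m)`, which bounds that of `Y` above; the extra degree absorbs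
  -- the linear term `x * m`.
  refine exists_eq_gaussianReal_of_complexMGF_ne_zero (ν := μ.map Y)
    (fun t => (integrable_map_measure (by fun_prop) hY.aemeasurable).2 (hintY t)) ?_
    (C := K + |m| + 1) (by positivity) (d := P.natDegree + 1) ?_
  · intro z h0
    rw [complexMGF_id_map hY.aemeasurable] at h0
    have := hmul z
    rw [h0, zero_mul] at this
    exact exp_ne_zero _ this.symm
  · intro x
    rw [mgf_id_map hY.aemeasurable]
    have h1 : mgf Y μ x * mgf T μ x = Real.exp (P.eval (x : ℂ)).re := by
      have h2 := congrArg norm (hmul x)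
      rwa [norm_mul, complexMGF_ofReal, complexMGF_ofReal, norm_exp, norm_real, norm_real,
        Real.norm_of_nonneg mgf_nonneg, Real.norm_of_nonneg mgf_nonneg] at h2
    have h3 := exp_mul_integral_le_mgf hTi (hintT x)
    have h4 : mgf Y μ x * Real.exp (x * m) ≤ Real.exp (P.eval (x : ℂ)).re := by
      rw [← h1]
      exact mul_le_mul_of_nonneg_left h3 mgf_nonneg
    have h5 : mgf Y μ x ≤ Real.exp ((P.eval (x : ℂ)).re - x * m) := by
      rw [Real.exp_sub, le_div_iff₀ (Real.exp_pos _)]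
      exact h4
    refine h5.trans (Real.exp_le_exp.2 ?_)
    have h6 : (P.eval (x : ℂ)).re ≤ K * (1 + |x|) ^ P.natDegree := by
      have := (re_le_norm _).trans (hK x)
      simpa using this
    have h7 : -(x * m) ≤ |m| * (1 + |x|) := by
      have : -(x * m) ≤ |x * m| := neg_le_abs _
      rw [abs_mul] at this
      nlinarith [abs_nonneg m, abs_nonneg x]
    have hx1 : 1 ≤ 1 + |x| := by linarith [abs_nonneg x]
    have h8 : (1 + |x|) ^ P.natDegree ≤ (1 + |x|) ^ (P.natDegree + 1) :=
      pow_le_pow_right₀ hx1 (Nat.le_succ _)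
    have h9 : 1 + |x| ≤ (1 + |x|) ^ (P.natDegree + 1) := le_self_pow₀ hx1 (by omega)
    have h10 : 0 ≤ (1 + |x|) ^ (P.natDegree + 1) := by positivity
    nlinarith [mul_le_mul_of_nonneg_left h8 hK0, mul_le_mul_of_nonneg_left h9 (abs_nonneg m)]

/-- **Darmois–Skitovich theorem** for square-integrable variables: a variable that occurs in both
of two independent linear forms is Gaussian. -/
theorem exists_map_eq_gaussianReal_of_indepFun_linear [Fintype ι] (hind : iIndepFun ε μ)
    (hm : ∀ i, Measurable (ε i)) (hL2 : ∀ i, MemLp (ε i) 2 μ) {a b : ι → ℝ}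
    (h : IndepFun (fun ω => ∑ i, a i * ε i ω) (fun ω => ∑ i, b i * ε i ω) μ) {i₀ : ι}
    (hi₀ : a i₀ * b i₀ ≠ 0) : ∃ m v, μ.map (ε i₀) = gaussianReal m v := by
  classical
  set S : Finset ι := Finset.univ.filter fun i => a i * b i ≠ 0 with hSdef
  have hS : ∀ i, i ∈ S ↔ a i * b i ≠ 0 := by simp [hSdef]
  obtain ⟨δ, hδ, hfac⟩ := exists_prod_charFun_eq_of_indepFun hind hm h hS
  have hprob : ∀ i, IsProbabilityMeasure (μ.map (ε i)) := fun i =>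
    Measure.isProbabilityMeasure_map (hm i).aemeasurable
  have hmomε : ∀ i ∈ S, ∀ n : ℕ, MemLp (ε i) n μ := fun i hi n =>
    memLp_of_indepFun_linear hind hm hL2 h ((hS i).1 hi) n
  have hmom : ∀ i ∈ S, ∀ n : ℕ, MemLp id n (μ.map (ε i)) := fun i hi n =>
    (memLp_map_measure_iff (by fun_prop) (hm i).aemeasurable).2 (hmomε i hi n)
  set κ : ℕ → ι → ℂ := fun n i => iteratedDeriv n (logDeriv (charFun (μ.map (ε i)))) 0 with hκ
  -- Restrict the factorization to the line `t = x * s` and compare derivatives of the logarithmic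
  -- derivative at `s = 0`.
  have hcum : ∀ (n : ℕ) (x : ℝ), ∑ i ∈ S, ((a i : ℂ) + x * b i) ^ (n + 1) * κ n i =
      ∑ i ∈ S, (a i : ℂ) ^ (n + 1) * κ n i + ∑ i ∈ S, ((x : ℂ) * b i) ^ (n + 1) * κ n i := by
    intro n x
    -- Two copies of the variables, with coefficients `a` and `x * b`, turn the right side into a
    -- single product.
    set ν : ι ⊕ ι → Measure ℝ := Sum.elim (fun i => μ.map (ε i)) (fun i => μ.map (ε i)) with hν
    have hνp : ∀ k, IsProbabilityMeasure (ν k) := by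
      rintro (k | k)
      · exact hprob k
      · exact hprob k
    have e1 := iteratedDeriv_logDeriv_prod_charFun S (fun i => μ.map (ε i)) hmom
      (fun i => a i + x * b i) n
    have e2 := iteratedDeriv_logDeriv_prod_charFun (S.disjSum S) ν (by
      rintro (k | k) hk
      · exact hmom k (Finset.inl_mem_disjSum.1 hk)
      · exact hmom k (Finset.inr_mem_disjSum.1 hk)) (Sum.elim a fun i => x * b i) n
    have hev : (fun s : ℝ => ∏ i ∈ S, charFun (μ.map (ε i)) ((a i + x * b i) * s)) =ᶠ[𝓝 0]
        fun s => ∏ k ∈ S.disjSum S, charFun (ν k) ((Sum.elim a fun i => x * b i) k * s) := by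
      have hs1 : ∀ᶠ s : ℝ in 𝓝 0, |s| < δ := by
        filter_upwards [Metric.ball_mem_nhds (0 : ℝ) hδ] with s hs
        simpa using hs
      have hs2 : ∀ᶠ s : ℝ in 𝓝 0, |x * s| < δ := by
        have hc : Continuous fun s : ℝ => |x * s| := by fun_prop
        have := hc.tendsto 0
        rw [mul_zero, abs_zero] at this
        exact this.eventually (gt_mem_nhds hδ)
      filter_upwards [hs1, hs2] with s h1 h2
      rw [Finset.prod_disjSum]
      have := hfac s (x * s) h1 h2
      simp only [hν, Sum.elim_inl, Sum.elim_inr]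
      have c1 : ∀ i, (a i + x * b i) * s = s * a i + x * s * b i := fun i => by ring
      have c2 : ∀ i, a i * s = s * a i := fun i => by ring
      have c3 : ∀ i, x * b i * s = x * s * b i := fun i => by ring
      simp_rw [c1, c2, c3]
      exact this
    have hev' : (logDeriv fun s : ℝ => ∏ i ∈ S, charFun (μ.map (ε i)) ((a i + x * b i) * s))
        =ᶠ[𝓝 0] logDeriv
          fun s => ∏ k ∈ S.disjSum S, charFun (ν k) ((Sum.elim a fun i => x * b i) k * s) :=
      hev.deriv.div hev
    rw [hev'.iteratedDeriv_eq, e2, Finset.sum_disjSum] at e1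
    simp only [hν, Sum.elim_inl, Sum.elim_inr] at e1
    push_cast at e1
    exact e1.symm
  -- Variables with the same ratio cannot be separated by the cumulant relations. Only their sum `∑
  -- i ∈ g, a i * ε i` is seen to have vanishing cumulants of order above `S.card`; independence
  -- then isolates the summand of `i₀`.
  set g : Finset ι := S.filter fun i => b i / a i = b i₀ / a i₀ with hg
  have hi₀S : i₀ ∈ S := (hS i₀).2 hi₀
  have hi₀g : i₀ ∈ g := by simp [hg, hi₀S]
  have hgS : ∀ i ∈ g, i ∈ S := fun i hi => (Finset.mem_filter.1 hi).1
  have hvanish : ∀ n, S.card ≤ n → ∑ i ∈ g, (a i : ℂ) ^ (n + 1) * κ n i = 0 := by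
    intro n hn
    refine sum_filter_ratio_eq_zero S (κ n) a b (fun i hi => (hS i).1 hi) (n + 1) (by omega) ?_ hi₀S
    intro q hq0 hqN
    exact sum_mul_pow_mul_pow_eq_zero S (κ n) (fun i => a i) (fun i => b i) (n + 1)
      (hcum n) hq0 hqN
  have hsum : ∀ ω, ∑ i ∈ g, a i * ε i ω = a i₀ * ε i₀ ω + ∑ i ∈ g.erase i₀, a i * ε i ω := fun ω =>
    (Finset.add_sum_erase g (fun i => a i * ε i ω) hi₀g).symm
  have hchar : charFun (μ.map fun ω => a i₀ * ε i₀ ω + ∑ i ∈ g.erase i₀, a i * ε i ω) =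
      fun s => ∏ i ∈ g, charFun (μ.map (ε i)) (a i * s) := by
    funext s
    simp_rw [← hsum]
    rw [charFun_apply_real, integral_map (by fun_prop) (by fun_prop),
      ← integral_exp_linear hind hm]
    refine integral_congr_ae (ae_of_all _ fun ω => ?_)
    simp only
    congr 2
    push_cast
    rw [Finset.mul_sum]
    refine Finset.sum_congr rfl fun i _ => ?_
    ring
  have hindep : IndepFun (fun ω => a i₀ * ε i₀ ω) (fun ω => ∑ i ∈ g.erase i₀, a i * ε i ω) μ := by
    have := indepFun_linear hind hm (S := {i₀}) (T := g.erase i₀) (by simp) a a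
    simpa using this
  obtain ⟨m, v, hmv⟩ := exists_map_eq_gaussianReal_of_indepFun_add
    (Y := fun ω => a i₀ * ε i₀ ω) (T := fun ω => ∑ i ∈ g.erase i₀, a i * ε i ω)
    (by fun_prop) (by fun_prop) hindep
    (integrable_finsetSum _ fun i _ => ((hL2 i).integrable (by norm_num)).const_mul _)
    (fun n => by
      simp_rw [← hsum]
      exact memLp_finsetSum g fun i hi => (hmomε i (hgS i hi) n).const_mul (a i))
    (N := S.card) (fun n hn => by
      rw [hchar, iteratedDeriv_logDeriv_prod_charFun g _ (fun i hi => hmom i (hgS i hi))]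
      exact hvanish n hn)
  have ha : a i₀ ≠ 0 := (mul_ne_zero_iff.1 hi₀).1
  have hback : μ.map (ε i₀) = (μ.map fun ω => a i₀ * ε i₀ ω).map fun x => (a i₀)⁻¹ * x := by
    rw [Measure.map_map (by fun_prop) (by fun_prop)]
    congr 1
    funext ω
    simp [ha]
  rw [hback, hmv, gaussianReal_map_const_mul]
  exact ⟨_, _, rfl⟩

end DarmoisSkitovich

/-! ### Directed walks, active paths and backdoor paths. -/

namespace LinearSEM

section GraphLemmas

open Relation

variable {V : Type*} {G : Digraph V}

theorem IsAcyclic.not_adj_symm (hG : IsAcyclic G) {u v : V} (h : G.Adj u v) : ¬ G.Adj v u :=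
  fun h' => hG u ((TransGen.single h).tail h')

theorem IsAcyclic.not_transGen_of_reflTransGen (hG : IsAcyclic G) {u v : V}
    (h : ReflTransGen G.Adj u v) : ¬ TransGen G.Adj v u :=
  fun h' => hG v (h'.trans_left h)

theorem IsAcyclic.wellFounded [Finite V] (hG : IsAcyclic G) : WellFounded (TransGen G.Adj) := by
  have : Std.Irrefl (TransGen G.Adj) := ⟨hG⟩
  exact Finite.wellFounded_of_trans_of_irrefl _

theorem IsAcyclic.wellFounded_swap [Finite V] (hG : IsAcyclic G) :
    WellFounded (Function.swap (TransGen G.Adj)) := by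
  have : Std.Irrefl (Function.swap (TransGen G.Adj)) := ⟨hG⟩
  exact Finite.wellFounded_of_trans_of_irrefl _

theorem isActive_empty_iff {p : List V} : IsActive G ∅ p ↔ ∀ v, ¬ IsColliderOn G p v := by
  constructor
  · intro h v hv
    have hmem : v ∈ p := by
      obtain ⟨u, w, hinf, -⟩ := hv
      exact hinf.subset (by simp)
    rcases h v hmem with h' | h'
    · exact h'.1 hv
    · simpa using h'.2
  · intro h v _
    exact Or.inl ⟨h v, by simp⟩

theorem not_isColliderOn_of_isChain (hG : IsAcyclic G) {p : List V} (hp : p.IsChain G.Adj) (v : V) :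
    ¬ IsColliderOn G p v := by
  rintro ⟨u, w, hinf, -, hwv⟩
  have := hp.infix hinf
  simp only [List.isChain_cons_cons] at this
  exact hG.not_adj_symm hwv this.2.1

/-- The only new interior vertex is `y`, and its edge to `x` leaves `y`. -/
theorem not_isColliderOn_cons (hG : IsAcyclic G) {x y : V} {l : List V} (hyx : G.Adj y x)
    (hl : ∀ v, ¬ IsColliderOn G (y :: l) v) (v : V) : ¬ IsColliderOn G (x :: y :: l) v := by
  rintro ⟨u, w, hinf, huv, hwv⟩
  rcases List.infix_cons_iff.1 hinf with hpre | hinf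
  · simp only [List.cons_prefix_cons] at hpre
    obtain ⟨rfl, rfl, -⟩ := hpre
    exact hG.not_adj_symm hyx huv
  · exact hl v ⟨u, w, hinf, huv, hwv⟩

/-- In an acyclic graph, every nonempty directed walk is realized by a list of distinct vertices. -/
theorem exists_directed_path (hG : IsAcyclic G) {R : V → V → Prop}
    (hR : ∀ u v, R u v → G.Adj u v) {a b : V} (h : TransGen R a b) :
    ∃ l : List V, (a :: l).Nodup ∧ (a :: l).getLast? = some b ∧ (a :: l).IsChain R ∧
      (∀ v ∈ l, TransGen R a v) ∧ (∀ v ∈ a :: l, ReflTransGen R v b) ∧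
      ∃ w, [w, b] <:+ a :: l ∧ R w b := by
  induction h using TransGen.head_induction_on with
  | @single a h =>
    refine ⟨[b], ?_, by simp, by simpa using h, by simpa using TransGen.single h, ?_,
      a, List.suffix_refl _, h⟩
    · have : a ≠ b := by
        rintro rfl
        exact hG a (TransGen.single (hR _ _ h))
      simpa using this
    · intro v hv
      rcases List.mem_cons.1 hv with rfl | hv
      · exact ReflTransGen.single h
      · rw [List.mem_singleton.1 hv]
  | @head a c h hcb ih =>
    obtain ⟨l, hnd, hlast, hchain, hreach, hto, w, hw, hwb⟩ := ih
    have hreach' : ∀ v ∈ c :: l, TransGen R a v := by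
      intro v hv
      rcases List.mem_cons.1 hv with rfl | hv
      · exact TransGen.single h
      · exact TransGen.head h (hreach v hv)
    refine ⟨c :: l, ?_, ?_, ?_, hreach', ?_, w, hw.trans (List.suffix_cons _ _), hwb⟩
    · refine List.nodup_cons.2 ⟨fun ha => ?_, hnd⟩
      exact hG a (TransGen.mono hR a a (hreach' a ha))
    · rw [List.getLast?_cons_cons]
      exact hlast
    · exact List.isChain_cons_cons.2 ⟨h, hchain⟩
    · intro v hv
      rcases List.mem_cons.1 hv with rfl | hv
      · exact ReflTransGen.head h hcb.to_reflTransGen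
      · exact hto v hv

theorem exists_active_frontdoorPath (hG : IsAcyclic G) {a b : V} (h : IsAncestor G a b) :
    ∃ p, IsFrontdoorPath G a b p ∧ IsActive G ∅ p ∧ ∀ v ∈ p, ReflTransGen G.Adj a v := by
  obtain ⟨l, hnd, hlast, hchain, hreach, -, w, hw, -⟩ := exists_directed_path hG (fun _ _ h => h) h
  refine ⟨a :: l, ⟨⟨hnd, by simp, hlast, hchain.imp fun _ _ h => Or.inl h⟩, ?_, hchain⟩,
    isActive_empty_iff.2 (not_isColliderOn_of_isChain hG hchain), ?_⟩
  · simpa using hw.length_le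
  · intro v hv
    rcases List.mem_cons.1 hv with rfl | hv
    · exact ReflTransGen.refl
    · exact (hreach v hv).to_reflTransGen

theorem reflTransGen_of_isChain {R : V → V → Prop} {l : List V} {a b : V}
    (h : (a :: l).IsChain R) (hl : (a :: l).getLast? = some b) : ReflTransGen R a b := by
  induction l generalizing a with
  | nil =>
    simp only [List.getLast?_singleton, Option.some.injEq] at hl
    rw [hl]
  | cons c l ih =>
    rw [List.isChain_cons_cons] at h
    rw [List.getLast?_cons_cons] at hl
    exact ReflTransGen.head h.1 (ih h.2 hl)

theorem IsFrontdoorPath.isAncestor {a b : V} {p : List V} (h : IsFrontdoorPath G a b p) :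
    IsAncestor G a b := by
  obtain ⟨⟨-, hhead, hlast, -⟩, hlen, hchain⟩ := h
  match p, hlen with
  | x :: y :: l, _ =>
    simp only [List.head?_cons, Option.some.injEq] at hhead
    subst hhead
    rw [List.isChain_cons_cons] at hchain
    rw [List.getLast?_cons_cons] at hlast
    exact TransGen.head' hchain.1 (reflTransGen_of_isChain hchain.2 hlast)

/-- A directed path from `a` stays among the descendants of `a`, so conditioning on all
nondescendants does not block it. -/
theorem not_dSeparated_of_isAncestor (hG : IsAcyclic G) {a b : V} (h : IsAncestor G a b) :
    ¬ DSeparated G a b {v | ¬ ReflTransGen G.Adj a v} := by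
  obtain ⟨p, hp, hact, hreach⟩ := exists_active_frontdoorPath hG h
  intro hsep
  refine hsep p hp.1 fun v hv => Or.inl ⟨isActive_empty_iff.1 hact v, ?_⟩
  simpa using hreach v hv

/-- The tail of an active backdoor path between `i` and `j` connects a parent of `i` with `j` and is
active given `i`. -/
theorem IsBackdoorPath.exists_parent {i j : V} {p : List V} (hp : IsBackdoorPath G i j p)
    (hact : IsActive G ∅ p) : ∃ u, G.Adj u i ∧ ¬ DSeparated G u j {i} := by
  obtain ⟨⟨hnd, -, hlast, hchain⟩, ⟨u, ⟨l, rfl⟩, hui⟩, -⟩ := hp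
  rw [List.cons_append, List.cons_append, List.nil_append] at hnd hlast hchain hact
  rw [isActive_empty_iff] at hact
  rw [List.nodup_cons] at hnd
  refine ⟨u, hui, fun hsep => hsep (u :: l) ⟨hnd.2, by simp, ?_, ?_⟩ ?_⟩
  · rwa [List.getLast?_cons_cons] at hlast
  · exact (List.isChain_cons_cons.1 hchain).2
  · intro v hv
    refine Or.inl ⟨?_, ?_⟩
    · rintro ⟨x, w, hinf, hx, hw⟩
      exact hact v ⟨x, w, List.infix_cons hinf, hx, hw⟩
    · rintro rfl
      exact hnd.1 hv

/-- If some ancestor `k` of `i` reaches the descendant `j` of `i` by a directed walk that avoids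
`i`, there is an active backdoor path between `i` and `j`. -/
theorem exists_active_backdoorPath [Finite V] (hG : IsAcyclic G) {i j k : V}
    (hij : IsAncestor G i j) (hki : IsAncestor G k i)
    (hkj : ReflTransGen (fun u v => G.Adj u v ∧ v ≠ i) k j) :
    ∃ p, IsBackdoorPath G i j p ∧ IsActive G ∅ p := by
  set R : V → V → Prop := fun u v => G.Adj u v ∧ v ≠ i with hRdef
  have hR : ∀ u v, R u v → G.Adj u v := fun u v h => h.1
  -- The branching point is chosen as far downstream as possible, so that the branches from `m` to
  -- `i` and to `j` meet only in `m`.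
  obtain ⟨m, ⟨hmi, hmj⟩, hmax⟩ := hG.wellFounded_swap.has_min
    {m | IsAncestor G m i ∧ ReflTransGen R m j} ⟨k, hki, hkj⟩
  have hmj' : TransGen R m j := by
    rcases reflTransGen_iff_eq_or_transGen.1 hmj with h | h
    · subst h
      exact absurd (TransGen.trans hij hmi) (hG i)
    · exact h
  have hm_ne : m ≠ i := by
    rintro rfl
    exact hG _ hmi
  obtain ⟨l, hnd, hlast, hchain, hreach, hto, w, hw, hwb⟩ := exists_directed_path hG hR hmj'
  -- The path grows backwards from the branch towards `j`, one edge at a time along a walk from `m`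
  -- to `i`. Each vertex on it is recorded either as reaching the current end `x` or as reaching `j`
  -- off `i`.
  have key : ∀ x, ReflTransGen G.Adj m x → ReflTransGen G.Adj x i →
      ∃ l : List V, (x :: l).Nodup ∧ (x :: l).getLast? = some j ∧
        (x :: l).IsChain (fun u v => G.Adj u v ∨ G.Adj v u) ∧
        (∀ v, ¬ IsColliderOn G (x :: l) v) ∧ [w, j] <:+ x :: l ∧
        (∀ v ∈ x :: l, ReflTransGen G.Adj v x ∨ (v ≠ i ∧ ReflTransGen R v j)) ∧
        (x = m ∨ ∃ u, [x, u] <+: x :: l ∧ G.Adj u x) := by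
    intro x hmx
    induction hmx with
    | refl =>
      intro _
      refine ⟨l, hnd, hlast, hchain.imp fun _ _ h => Or.inl h.1,
        not_isColliderOn_of_isChain hG (hchain.imp hR), hw, fun v hv => Or.inr ⟨?_, hto v hv⟩,
        Or.inl rfl⟩
      rcases List.mem_cons.1 hv with rfl | hv
      · exact hm_ne
      · obtain ⟨u, -, hu⟩ := TransGen.tail'_iff.1 (hreach v hv)
        exact hu.2
    | @tail x y hmx hxy ih =>
      intro hyi
      obtain ⟨l, hnd, hlast, hchain, hcol, hsuf, hmem, -⟩ := ih (ReflTransGen.head hxy hyi)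
      refine ⟨x :: l, List.nodup_cons.2 ⟨fun hy => ?_, hnd⟩, ?_,
        List.isChain_cons_cons.2 ⟨Or.inr hxy, hchain⟩, not_isColliderOn_cons hG hxy hcol,
        hsuf.trans (List.suffix_cons _ _), ?_, Or.inr ⟨x, ⟨l, rfl⟩, hxy⟩⟩
      -- A repeated vertex would close a cycle in the first case, and in the second would be a
      -- branching point downstream of `m`.
      · rcases hmem y hy with h | ⟨hne, h⟩
        · exact hG.not_transGen_of_reflTransGen h (TransGen.single hxy)
        · have hyi' : TransGen G.Adj y i := by
            rcases reflTransGen_iff_eq_or_transGen.1 hyi with h' | h'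
            · exact absurd h'.symm hne
            · exact h'
          exact hmax y ⟨hyi', h⟩ (TransGen.tail' hmx hxy)
      · rw [List.getLast?_cons_cons]
        exact hlast
      · intro v hv
        rcases List.mem_cons.1 hv with rfl | hv
        · exact Or.inl ReflTransGen.refl
        · exact (hmem v hv).imp (fun h => h.tail hxy) id
  obtain ⟨l', hnd', hlast', hchain', hcol', hsuf', -, hfirst⟩ :=
    key i (TransGen.to_reflTransGen hmi) ReflTransGen.refl
  exact ⟨i :: l', ⟨⟨hnd', by simp, hlast', hchain'⟩, hfirst.resolve_left (Ne.symm hm_ne),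
    w, hsuf', hwb.1⟩, isActive_empty_iff.2 hcol'⟩

end GraphLemmas

end LinearSEM

/-! ### Conditional independence from independent noise. -/

section ConditionalIndependence

variable {Ω' 𝓦 : Type*} [MeasurableSpace Ω'] [MeasurableSpace 𝓦] {P : Measure Ω'}
  [IsProbabilityMeasure P]

/-- If `N` is independent of `U`, the joint law of `U` and `f (π U, N)` disintegrates over the law
of `U` along the laws of `f (w, N)`. -/
theorem map_prodMk_eq_compProd_of_indepFun {𝓤 : Type*} [MeasurableSpace 𝓤] {U : Ω' → 𝓤}
    {N : Ω' → ℝ} (hU : Measurable U) (hN : Measurable N) (hind : IndepFun U N P) {π : 𝓤 → 𝓦}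
    (hπ : Measurable π) {f : 𝓦 × ℝ → ℝ} (hf : Measurable f) :
    P.map (fun ω => (U ω, f (π (U ω), N ω))) =
      (P.map U).compProd
        (((Kernel.id ×ₖ Kernel.const 𝓦 (P.map N)).map f).comap π hπ) := by
  have hpN : IsProbabilityMeasure (P.map N) := Measure.isProbabilityMeasure_map hN.aemeasurable
  have hpU : IsProbabilityMeasure (P.map U) := Measure.isProbabilityMeasure_map hU.aemeasurable
  have hX : Measurable fun ω => (U ω, f (π (U ω), N ω)) := by fun_prop
  have hpX : IsProbabilityMeasure (P.map fun ω => (U ω, f (π (U ω), N ω))) :=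
    Measure.isProbabilityMeasure_map hX.aemeasurable
  have hk : IsMarkovKernel ((Kernel.id ×ₖ Kernel.const 𝓦 (P.map N)).map f) :=
    Kernel.IsMarkovKernel.map _ hf
  refine Measure.ext_prod_iff.2 fun {s t} hs ht => ?_
  have hset : MeasurableSet {q : 𝓤 × ℝ | q.1 ∈ s ∧ f (π q.1, q.2) ∈ t} := by
    refine (measurable_fst hs).inter ?_
    have : Measurable fun q : 𝓤 × ℝ => f (π q.1, q.2) := by fun_prop
    exact this ht
  have h1 : P.map (fun ω => (U ω, f (π (U ω), N ω))) (s ×ˢ t) =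
      P.map (fun ω => (U ω, N ω)) {q : 𝓤 × ℝ | q.1 ∈ s ∧ f (π q.1, q.2) ∈ t} := by
    rw [Measure.map_apply hX (hs.prod ht), Measure.map_apply (hU.prodMk hN) hset]
    rfl
  rw [h1, (indepFun_iff_map_prod_eq_prod_map_map hU.aemeasurable hN.aemeasurable).1 hind,
    Measure.prod_apply hset, Measure.compProd_apply_prod hs ht, ← lintegral_indicator hs]
  refine lintegral_congr fun u => ?_
  by_cases hu : u ∈ s
  · rw [Set.indicator_of_mem hu, Kernel.comap_apply, Kernel.map_apply' _ hf _ ht,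
      Kernel.prod_apply, Kernel.id_apply, Kernel.const_apply, Measure.dirac_prod,
      Measure.map_apply (by fun_prop) (hf ht)]
    simp only [Set.preimage_ofPred_eq, hu, true_and]
    rfl
  · rw [Set.indicator_of_notMem hu]
    simp [hu]

/-- If `N` is independent of `(W, Y)`, then every function of `W` and `N` is conditionally
independent of `Y` given `W`. -/
theorem condIndepFun_of_indepFun_prodMk [StandardBorelSpace Ω'] {W : Ω' → 𝓦} {N Y : Ω' → ℝ}
    (hW : Measurable W) (hN : Measurable N) (hY : Measurable Y)
    (hind : IndepFun (fun ω => (W ω, Y ω)) N P) {f : 𝓦 × ℝ → ℝ} (hf : Measurable f) :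
    CondIndepFun (MeasurableSpace.comap W inferInstance) hW.comap_le Y
      (fun ω => f (W ω, N ω)) P := by
  have hpN : IsProbabilityMeasure (P.map N) := Measure.isProbabilityMeasure_map hN.aemeasurable
  have hk : IsMarkovKernel ((Kernel.id ×ₖ Kernel.const 𝓦 (P.map N)).map f) :=
    Kernel.IsMarkovKernel.map _ hf
  have hX : Measurable fun ω => f (W ω, N ω) := by fun_prop
  rw [condIndepFun_iff_condDistrib_prod_ae_eq_prodMkRight hX hY hW]
  -- The same kernel, the law of `f (w, N)`, serves as conditional law given `W` and given `(W, Y)`;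
  -- hence `Y` adds no information.
  have h1 := condDistrib_ae_eq_of_measure_eq_compProd W hX.aemeasurable
    (map_prodMk_eq_compProd_of_indepFun hW hN
      (hind.comp measurable_fst measurable_id : IndepFun W N P) measurable_id hf)
  have h2 := condDistrib_ae_eq_of_measure_eq_compProd (fun ω => (W ω, Y ω)) hX.aemeasurable
    (map_prodMk_eq_compProd_of_indepFun (hW.prodMk hY) hN hind measurable_fst hf)
  have hfst : P.map W = (P.map fun ω => (W ω, Y ω)).map Prod.fst := by
    rw [Measure.map_map measurable_fst (hW.prodMk hY)]
    rfl
  rw [hfst] at h1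
  filter_upwards [h2, ae_of_ae_map measurable_fst.aemeasurable h1] with q hq1 hq2
  rw [hq1, Kernel.prodMkRight_apply, hq2]
  rfl

end ConditionalIndependence

namespace LinearSEM

/-- On coordinate space the noise is recovered as `x a - h (x_Z)`, so its independence transfers to
the joint law. This is the source of the conditional independences to which faithfulness is applied.
-/
theorem condIndepCoord_of_indepFun {V Ω : Type*} [Fintype V] [MeasurableSpace Ω] {μ : Measure Ω}
    [IsProbabilityMeasure μ] {X : V → Ω → ℝ} (hX : ∀ v, Measurable (X v)) {a b : V} {Z : Set V}
    {h : (Z → ℝ) → ℝ} (hh : Measurable h) {N : Ω → ℝ}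
    (hXa : ∀ ω, X a ω = h (fun k : Z => X k ω) + N ω)
    (hind : IndepFun N (fun ω => ((fun k : Z => X k ω), X b ω)) μ) :
    CondIndepCoord (μ.map (fun ω v => X v ω)) b a Z := by
  have hXm : Measurable fun ω v => X v ω := measurable_pi_lambda _ hX
  have hP : IsProbabilityMeasure (μ.map fun ω v => X v ω) :=
    Measure.isProbabilityMeasure_map hXm.aemeasurable
  have hW : Measurable fun (x : V → ℝ) (k : Z) => x k :=
    measurable_pi_lambda _ fun k => measurable_pi_apply (k : V)
  have hNm : Measurable fun x : V → ℝ => x a - h fun k : Z => x k := by fun_prop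
  have hind' : IndepFun (fun x : V → ℝ => ((fun k : Z => x k), x b))
      (fun x : V → ℝ => x a - h fun k : Z => x k) (μ.map fun ω v => X v ω) := by
    have hN : N = (fun x : V → ℝ => x a - h fun k : Z => x k) ∘ fun ω v => X v ω := by
      funext ω
      simp [hXa ω]
    rw [indepFun_iff_measure_inter_preimage_eq_mul] at hind ⊢
    intro s t hs ht
    have h1 : MeasurableSet ((fun x : V → ℝ => ((fun k : Z => x k), x b)) ⁻¹' s) :=
      (hW.prodMk (measurable_pi_apply b)) hs
    rw [Measure.map_apply hXm (h1.inter (hNm ht)), Measure.map_apply hXm h1,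
      Measure.map_apply hXm (hNm ht)]
    have := hind t s ht hs
    rw [hN, Set.inter_comm, mul_comm] at this
    exact this
  have key := condIndepFun_of_indepFun_prodMk hW hNm (measurable_pi_apply b) hind'
    (f := fun q => h q.1 + q.2) (by fun_prop)
  unfold CondIndepCoord
  convert key using 2
  ring

end LinearSEM

namespace LinearSEM

/-! ### Reversal of paths. -/

section GraphSymmetry

variable {V : Type*} {G : Digraph V}

theorem IsColliderOn.reverse {p : List V} {v : V} (h : IsColliderOn G p v) :
    IsColliderOn G p.reverse v := by
  obtain ⟨u, w, hinf, hu, hw⟩ := h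
  exact ⟨w, u, by simpa using List.reverse_infix.2 hinf, hw, hu⟩

theorem IsActive.reverse_of_empty {p : List V} (h : IsActive G ∅ p) : IsActive G ∅ p.reverse := by
  rw [isActive_empty_iff] at h ⊢
  intro v hv
  exact h v (by simpa using hv.reverse)

theorem IsBackdoorPath.reverse {a b : V} {p : List V} (h : IsBackdoorPath G a b p) :
    IsBackdoorPath G b a p.reverse := by
  obtain ⟨⟨hnd, hhead, hlast, hchain⟩, ⟨u, hu, hua⟩, w, hw, hwb⟩ := h
  refine ⟨⟨List.nodup_reverse.2 hnd, by simpa using hlast, by simpa using hhead, ?_⟩,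
    ⟨w, by simpa using List.reverse_prefix.2 hw, hwb⟩,
    u, by simpa using List.reverse_suffix.2 hu, hua⟩
  rw [List.isChain_reverse]
  exact hchain.imp fun _ _ h => h.symm

theorem AP3.symm {a b : V} (h : AP3 G a b) : AP3 G b a := by
  obtain ⟨⟨p, hp, hact⟩, hno⟩ := h
  exact ⟨⟨p, hp.symm, hact⟩, fun ⟨q, hq, hqa⟩ => hno ⟨q.reverse, hq.reverse, hqa.reverse_of_empty⟩⟩

theorem AP3.isAncestor_or {a b : V} (h : AP3 G a b) : IsAncestor G a b ∨ IsAncestor G b a := by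
  obtain ⟨⟨p, hp, -⟩, -⟩ := h
  exact hp.imp IsFrontdoorPath.isAncestor IsFrontdoorPath.isAncestor

end GraphSymmetry

/-! ### The matrix of total effects. -/

section TotalEffects

open Relation

variable {V : Type*} [Fintype V] [DecidableEq V] {G : Digraph V} {A B : Matrix V V ℝ}

/-- The matrix of total effects of an acyclic linear model. -/
theorem exists_eq_one_add_mul (hG : IsAcyclic G) (hB : ∀ i j, B i j ≠ 0 → G.Adj j i) :
    ∃ A : Matrix V V ℝ, A = 1 + B * A := by
  classical
  -- Row `i` of `A = 1 + B * A` involves only rows of parents of `i`, so it can be solved by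
  -- recursion along the ancestor order.
  let F : (i : V) → ((j : V) → TransGen G.Adj j i → V → ℝ) → V → ℝ := fun i rec k =>
    (1 : Matrix V V ℝ) i k + ∑ j, if h : TransGen G.Adj j i then B i j * rec j h k else 0
  refine ⟨Matrix.of (hG.wellFounded.fix F), ?_⟩
  ext i k
  rw [Matrix.of_apply, WellFounded.fix_eq, Matrix.add_apply, Matrix.mul_apply]
  refine congrArg ((1 : Matrix V V ℝ) i k + ·) (Finset.sum_congr rfl fun j _ => ?_)
  split_ifs with h
  · rfl
  · have : B i j = 0 := by
      by_contra h0
      exact h (TransGen.single (hB i j h0))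
    simp [this]

theorem totalEffect_apply (hA : A = 1 + B * A) (i k : V) :
    A i k = (if i = k then 1 else 0) + ∑ j, B i j * A j k := by
  have h := congrFun (congrFun hA i) k
  rwa [Matrix.add_apply, Matrix.mul_apply, Matrix.one_apply] at h

/-- A nonzero entry must come from a nonzero term through some parent, and one climbs on to `k`. The
converse can fail by cancellation between walks. -/
theorem reflTransGen_of_totalEffect_ne_zero (hG : IsAcyclic G)
    (hB : ∀ i j, B i j ≠ 0 → G.Adj j i) (hA : A = 1 + B * A) {i k : V} (h : A i k ≠ 0) :
    ReflTransGen G.Adj k i := by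
  induction i using hG.wellFounded.induction with
  | _ i ih =>
    by_cases hik : i = k
    · rw [hik]
    · rw [totalEffect_apply hA, if_neg hik, zero_add] at h
      obtain ⟨j, -, hj⟩ := Finset.exists_ne_zero_of_sum_ne_zero h
      have hadj := hB i j (left_ne_zero_of_mul hj)
      exact (ih j (TransGen.single hadj) (right_ne_zero_of_mul hj)).tail hadj

theorem totalEffect_self (hG : IsAcyclic G) (hB : ∀ i j, B i j ≠ 0 → G.Adj j i)
    (hA : A = 1 + B * A) (i : V) : A i i = 1 := by
  rw [totalEffect_apply hA, if_pos rfl, Finset.sum_eq_zero, add_zero]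
  intro j _
  by_contra h
  have hadj := hB i j (left_ne_zero_of_mul h)
  exact hG.not_transGen_of_reflTransGen
    (reflTransGen_of_totalEffect_ne_zero hG hB hA (right_ne_zero_of_mul h)) (TransGen.single hadj)

/-- If every directed walk from `k` to `l` passes through `i`, the total effect of `k` on `l` is
mediated by `i`. -/
theorem totalEffect_eq_mul (hG : IsAcyclic G) (hB : ∀ i j, B i j ≠ 0 → G.Adj j i)
    (hA : A = 1 + B * A) {i k l : V}
    (h : ¬ ReflTransGen (fun u v => G.Adj u v ∧ v ≠ i) k l) : A l k = A l i * A i k := by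
  induction l using hG.wellFounded.induction with
  | _ l ih =>
    by_cases hli : l = i
    · rw [hli, totalEffect_self hG hB hA, one_mul]
    · have hlk : l ≠ k := by
        rintro rfl
        exact h ReflTransGen.refl
      rw [totalEffect_apply hA l k, totalEffect_apply hA l i, if_neg hli, if_neg hlk, zero_add,
        zero_add, Finset.sum_mul]
      refine Finset.sum_congr rfl fun m _ => ?_
      by_cases hm : B l m = 0
      · simp [hm]
      · have hadj := hB l m hm
        -- A walk to the parent `m` avoiding `i` would extend to `l`, which is not `i`.
        rw [ih m (TransGen.single hadj) fun h' => h (h'.tail ⟨hadj, hli⟩), mul_assoc]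

end TotalEffects

/-! ### Residuals, faithfulness and the AP3 relation. -/

section Model

open Relation

variable {V Ω : Type*} [Fintype V] [MeasurableSpace Ω] {μ : Measure Ω}
  {G : Digraph V} {A B : Matrix V V ℝ} {ε X : V → Ω → ℝ}

theorem IsLiNGAM.adj_of_ne_zero (hmodel : IsLiNGAM μ G B ε X) (i j : V) (h : B i j ≠ 0) :
    G.Adj j i := (hmodel.coeff_ne_zero_iff i j).1 h

theorem IsLiNGAM.variance_noise_pos [IsProbabilityMeasure μ] (hmodel : IsLiNGAM μ G B ε X) (i : V) :
    0 < variance (ε i) μ := by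
  refine lt_of_le_of_ne (variance_nonneg _ _) fun h => ?_
  have h1 := ae_eq_integral_of_variance_eq_zero (hmodel.memLp_noise i) h.symm
  refine hmodel.nonGaussian_noise i (∫ ω, ε i ω ∂μ) 0 ?_
  rw [gaussianReal_zero_var, Measure.map_congr h1, Measure.map_const]
  simp

/-- Two independent linear forms in the noise variables have no variable in common. -/
theorem IsLiNGAM.mul_eq_zero_of_indepFun [IsProbabilityMeasure μ] (hmodel : IsLiNGAM μ G B ε X) {a b : V → ℝ}
    (h : IndepFun (fun ω => ∑ k, a k * ε k ω) (fun ω => ∑ k, b k * ε k ω) μ) (k : V) :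
    a k * b k = 0 := by
  by_contra hk
  obtain ⟨m, v, hmv⟩ := exists_map_eq_gaussianReal_of_indepFun_linear hmodel.indep_noise
    hmodel.measurable_noise hmodel.memLp_noise h hk
  exact hmodel.nonGaussian_noise k m v hmv

/-- Centering only shifts the residual by a constant. -/
theorem indepFun_residual_iff {x y : Ω → ℝ} :
    IndepFun x (residual μ y x) μ ↔
      IndepFun x (fun ω => y ω - covariance x y μ / variance x μ * x ω) μ := by
  set c := covariance x y μ / variance x μ with hc
  constructor
  · intro h
    have := h.comp measurable_id
      (measurable_id.add_const (∫ ω, y ω ∂μ - c * ∫ ω, x ω ∂μ))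
    convert! this using 1
    funext ω
    simp only [Function.comp, id, residual, ← hc]
    ring
  · intro h
    have := h.comp measurable_id
      (measurable_id.sub_const (∫ ω, y ω ∂μ - c * ∫ ω, x ω ∂μ))
    convert! this using 1
    funext ω
    simp only [Function.comp, id, residual, ← hc]
    ring

variable [DecidableEq V]

theorem IsLiNGAM.eq_sum_totalEffect (hmodel : IsLiNGAM μ G B ε X) (hA : A = 1 + B * A) (i : V)
    (ω : Ω) : X i ω = ∑ k, A i k * ε k ω := by
  induction i using hmodel.acyclic.wellFounded.induction with
  | _ i ih =>
    have h1 : ∀ j, B i j * X j ω = ∑ k, B i j * A j k * ε k ω := by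
      intro j
      by_cases hj : B i j = 0
      · simp [hj]
      · rw [ih j (TransGen.single (hmodel.adj_of_ne_zero i j hj)), Finset.mul_sum]
        simp_rw [mul_assoc]
    rw [hmodel.structural i ω]
    simp_rw [h1]
    rw [Finset.sum_comm]
    have h2 : ∀ k, A i k * ε k ω =
        (if i = k then ε k ω else 0) + ∑ j, B i j * A j k * ε k ω := by
      intro k
      rw [totalEffect_apply hA, add_mul, Finset.sum_mul, ite_mul, one_mul, zero_mul]
    simp_rw [h2]
    rw [Finset.sum_add_distrib, Finset.sum_ite_eq, if_pos (Finset.mem_univ _), add_comm]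

theorem IsLiNGAM.measurable (hmodel : IsLiNGAM μ G B ε X) (hA : A = 1 + B * A) (i : V) :
    Measurable (X i) := by
  have h : X i = fun ω => ∑ k, A i k * ε k ω := funext (hmodel.eq_sum_totalEffect hA i)
  have := hmodel.measurable_noise
  rw [h]
  fun_prop

theorem IsLiNGAM.memLp (hmodel : IsLiNGAM μ G B ε X) (hA : A = 1 + B * A) (i : V) :
    MemLp (X i) 2 μ := by
  have h : X i = fun ω => ∑ k, A i k * ε k ω := funext (hmodel.eq_sum_totalEffect hA i)
  rw [h]
  exact memLp_finsetSum _ fun k _ => (hmodel.memLp_noise k).const_mul _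

/-- The noise present in `X i` cancels, leaving a form in the remaining noise variables. -/
theorem IsLiNGAM.sub_mul_eq_sum (hmodel : IsLiNGAM μ G B ε X) (hA : A = 1 + B * A) {i j : V} {c : ℝ}
    (h : ∀ k, A i k ≠ 0 → A j k = c * A i k) (ω : Ω) :
    X j ω - c * X i ω = ∑ k with A i k = 0, (A j k - c * A i k) * ε k ω := by
  rw [hmodel.eq_sum_totalEffect hA, hmodel.eq_sum_totalEffect hA, Finset.mul_sum,
    ← Finset.sum_sub_distrib, Finset.sum_filter]
  refine Finset.sum_congr rfl fun k _ => ?_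
  split_ifs with hk
  · ring
  · rw [h k hk]
    ring

theorem IsLiNGAM.eq_sum_of_support (hmodel : IsLiNGAM μ G B ε X) (hA : A = 1 + B * A) {m : V}
    {T : Finset V} (h : ∀ k, A m k ≠ 0 → k ∈ T) (ω : Ω) : X m ω = ∑ k ∈ T, A m k * ε k ω := by
  rw [hmodel.eq_sum_totalEffect hA]
  symm
  refine Finset.sum_subset (Finset.subset_univ T) fun k _ hk => ?_
  have : A m k = 0 := by
    by_contra h0
    exact hk (h k h0)
  simp [this]

/-- A linear form in noise variables is independent of every family of observed variables that do
not involve these noise variables. -/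
theorem IsLiNGAM.indepFun_linear_observed (hmodel : IsLiNGAM μ G B ε X) (hA : A = 1 + B * A)
    (S : Finset V) (c : V → ℝ) {Z : Set V} {b : V} (hZ : ∀ m ∈ Z, ∀ k ∈ S, A m k = 0)
    (hb : ∀ k ∈ S, A b k = 0) :
    IndepFun (fun ω => ∑ k ∈ S, c k * ε k ω) (fun ω => ((fun m : Z => X m ω), X b ω)) μ := by
  have h := indepFun_linear_family hmodel.indep_noise hmodel.measurable_noise (S := S) (T := Sᶜ)
    disjoint_compl_right c (fun o : Option Z => A (o.elim b (fun m => (m : V))))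
  have hφ : Measurable fun y : Option Z → ℝ => ((fun m : Z => y (some m)), y none) := by fun_prop
  have := h.comp measurable_id hφ
  convert! this using 1
  funext ω
  have hsupp : ∀ m, (∀ k ∈ S, A m k = 0) → X m ω = ∑ k ∈ Sᶜ, A m k * ε k ω := fun m hm =>
    hmodel.eq_sum_of_support hA (fun k hk => Finset.mem_compl.2 fun hkS => hk (hm k hkS)) ω
  refine Prod.ext (funext fun m => ?_) ?_
  · exact hsupp m (hZ m m.2)
  · exact hsupp b hb

theorem IsLiNGAM.indepFun_sub_mul (hmodel : IsLiNGAM μ G B ε X) (hA : A = 1 + B * A) {i j : V}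
    {c : ℝ} (h : ∀ k, A i k ≠ 0 → A j k = c * A i k) :
    IndepFun (X i) (fun ω => X j ω - c * X i ω) μ := by
  have hind := hmodel.indepFun_linear_observed hA (Finset.univ.filter fun k => A i k = 0)
    (fun k => A j k - c * A i k) (Z := ∅) (b := i) (by simp) (by simp)
  have h1 := (hind.comp measurable_id measurable_snd).symm
  convert! h1 using 1
  funext ω
  exact hmodel.sub_mul_eq_sum hA h ω

variable [IsProbabilityMeasure μ]

theorem IsLiNGAM.variance_pos (hmodel : IsLiNGAM μ G B ε X) (hA : A = 1 + B * A) (i : V) :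
    0 < variance (X i) μ := by
  have hsplit : X i = (fun ω => ε i ω) + fun ω => ∑ k ∈ Finset.univ.erase i, A i k * ε k ω := by
    funext ω
    rw [hmodel.eq_sum_totalEffect hA, ← Finset.add_sum_erase _ _ (Finset.mem_univ i),
      totalEffect_self hmodel.acyclic hmodel.adj_of_ne_zero hA, one_mul]
    rfl
  have hind : IndepFun (fun ω => ε i ω) (fun ω => ∑ k ∈ Finset.univ.erase i, A i k * ε k ω) μ := by
    have := indepFun_linear hmodel.indep_noise hmodel.measurable_noise (S := {i})
      (T := Finset.univ.erase i) (by simp) 1 (A i)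
    simpa using this
  rw [hsplit, hind.variance_add (hmodel.memLp_noise i)
    (memLp_finsetSum _ fun k _ => (hmodel.memLp_noise k).const_mul _)]
  exact add_pos_of_pos_of_nonneg (hmodel.variance_noise_pos i) (variance_nonneg _ _)

/-- If `x_i` is independent of the residual of `x_j`, the noise variables in `x_i` enter `x_j` only
through `x_i`. -/
theorem IsLiNGAM.totalEffect_eq_of_indepFun_residual (hmodel : IsLiNGAM μ G B ε X)
    (hA : A = 1 + B * A) {i j : V} (h : IndepFun (X i) (residual μ (X j) (X i)) μ) {k : V}
    (hk : A i k ≠ 0) :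
    A j k = covariance (X i) (X j) μ / variance (X i) μ * A i k := by
  set c := covariance (X i) (X j) μ / variance (X i) μ with hc
  rw [indepFun_residual_iff, ← hc] at h
  have h1 : IndepFun (fun ω => ∑ k, A i k * ε k ω)
      (fun ω => ∑ k, (A j k - c * A i k) * ε k ω) μ := by
    convert! h using 1
    · funext ω
      rw [hmodel.eq_sum_totalEffect hA]
    · funext ω
      rw [hmodel.eq_sum_totalEffect hA, hmodel.eq_sum_totalEffect hA, Finset.mul_sum,
        ← Finset.sum_sub_distrib]
      refine Finset.sum_congr rfl fun k _ => ?_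
      ring
  have h2 := (mul_eq_zero.1 (hmodel.mul_eq_zero_of_indepFun h1 k)).resolve_left hk
  linarith

/-- Under faithfulness the total effect of an ancestor does not vanish. -/
theorem IsLiNGAM.totalEffect_ne_zero (hmodel : IsLiNGAM μ G B ε X) (hA : A = 1 + B * A)
    (hfaithful : IsFaithful μ G X) {i k : V} (hki : IsAncestor G k i) : A i k ≠ 0 := by
  classical
  intro h0
  have hG := hmodel.acyclic
  have hne : i ≠ k := by
    rintro rfl
    exact hG _ hki
  -- Given the nondescendants of `k`, which include its parents, `X k` varies only through `ε k`. If
  -- `A i k = 0`, that noise is absent from `X i` and from all of `Z`, so `X k` and `X i` are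
  -- conditionally independent although a directed path joins them.
  set Z : Set V := {v | ¬ ReflTransGen G.Adj k v} with hZ
  have hind := hmodel.indepFun_linear_observed hA {k} 1 (Z := Z) (b := i) (by
    intro m hm l hl
    rw [Finset.mem_singleton.1 hl]
    by_contra h1
    exact hm (reflTransGen_of_totalEffect_ne_zero hG hmodel.adj_of_ne_zero hA h1)) (by simpa using h0)
  simp only [Finset.sum_singleton, Pi.one_apply, one_mul] at hind
  have hcond := condIndepCoord_of_indepFun (hmodel.measurable hA) (a := k) (b := i) (Z := Z)
    (h := fun y => ∑ j : V, if hj : j ∈ Z then B k j * y ⟨j, hj⟩ else 0) (by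
      refine Finset.measurable_sum _ fun j _ => ?_
      split_ifs <;> fun_prop) (N := ε k) (fun ω => by
      rw [hmodel.structural k ω]
      congr 1
      refine Finset.sum_congr rfl fun j _ => ?_
      split_ifs with hj
      · rfl
      · have : B k j = 0 := by
          by_contra hB
          exact hj fun hr => hG.not_transGen_of_reflTransGen hr
            (TransGen.single (hmodel.adj_of_ne_zero k j hB))
        simp [this]) hind
  refine not_dSeparated_of_isAncestor hG hki (hfaithful k i Z hne.symm ?_ ?_ hcond.symm)
  · simp [hZ, ReflTransGen.refl]
  · simpa [hZ] using hki.to_reflTransGen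

/-- Identifies the structural slope `c` with the regression coefficient. -/
theorem IsLiNGAM.covariance_eq (hmodel : IsLiNGAM μ G B ε X) (hA : A = 1 + B * A) {i j : V}
    {c : ℝ} (h : IndepFun (X i) (fun ω => X j ω - c * X i ω) μ) :
    covariance (X i) (X j) μ = c * variance (X i) μ := by
  have hi := hmodel.memLp hA i
  have hj := hmodel.memLp hA j
  have hci : MemLp (fun ω => c * X i ω) 2 μ := hi.const_mul c
  have hR : MemLp (fun ω => X j ω - c * X i ω) 2 μ := hj.sub hci
  have e : X j = (fun ω => c * X i ω) + fun ω => X j ω - c * X i ω := by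
    funext ω
    simp
  rw [e, covariance_add_right hi hci hR, covariance_const_mul_right,
    covariance_self (hmodel.measurable hA i).aemeasurable, h.covariance_eq_zero hi hR, add_zero]

/-- Without an active backdoor path, every walk from a proper ancestor of `i` to `j` passes through
`i`, so row `j` is `A j i` times row `i` on its support. In the reverse regression, `ε j` enters `X
j` but not `X i`, which would force slope 0 against the nonzero covariance. -/
theorem IsLiNGAM.of_AP3 (hmodel : IsLiNGAM μ G B ε X) (hA : A = 1 + B * A)
    (hfaithful : IsFaithful μ G X) {i j : V} (hap : AP3 G i j) (hij : IsAncestor G i j) :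
    ¬ IndepFun (X i) (X j) μ ∧ IndepFun (X i) (residual μ (X j) (X i)) μ ∧
      ¬ IndepFun (X j) (residual μ (X i) (X j)) μ := by
  have hG := hmodel.acyclic
  have hprop : ∀ k, A i k ≠ 0 → A j k = A j i * A i k := by
    intro k hk
    rcases reflTransGen_iff_eq_or_transGen.1
      (reflTransGen_of_totalEffect_ne_zero hG hmodel.adj_of_ne_zero hA hk) with rfl | hki
    · rw [totalEffect_self hG hmodel.adj_of_ne_zero hA, mul_one]
    · exact totalEffect_eq_mul hG hmodel.adj_of_ne_zero hA fun hkj =>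
        hap.2 (exists_active_backdoorPath hG hij hki hkj)
  have hind := hmodel.indepFun_sub_mul hA hprop
  have hcov := hmodel.covariance_eq hA hind
  have hvar := hmodel.variance_pos hA i
  have hji := hmodel.totalEffect_ne_zero hA hfaithful hij
  have hcov0 : covariance (X i) (X j) μ ≠ 0 := by
    rw [hcov]
    exact mul_ne_zero hji hvar.ne'
  refine ⟨fun h => hcov0 (h.covariance_eq_zero (hmodel.memLp hA i) (hmodel.memLp hA j)), ?_, ?_⟩
  · rw [indepFun_residual_iff, hcov, mul_div_cancel_right₀ _ hvar.ne']
    exact hind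
  · intro h
    have hjj := totalEffect_self hG hmodel.adj_of_ne_zero hA j
    have h1 := hmodel.totalEffect_eq_of_indepFun_residual hA h (k := j) (by rw [hjj]; exact one_ne_zero)
    have h2 : A i j = 0 := by
      by_contra h3
      exact hG.not_transGen_of_reflTransGen
        (reflTransGen_of_totalEffect_ne_zero hG hmodel.adj_of_ne_zero hA h3) hij
    rw [h2, hjj, mul_one, covariance_comm] at h1
    exact div_ne_zero hcov0 (hmodel.variance_pos hA j).ne' h1.symm

theorem IsLiNGAM.AP3_of_indepFun_residual (hmodel : IsLiNGAM μ G B ε X) (hA : A = 1 + B * A)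
    (hfaithful : IsFaithful μ G X) {i j : V} (hne : i ≠ j) (hdep : ¬ IndepFun (X i) (X j) μ)
    (hres : IndepFun (X i) (residual μ (X j) (X i)) μ) : AP3 G i j ∧ IsAncestor G i j := by
  have hG := hmodel.acyclic
  set c := covariance (X i) (X j) μ / variance (X i) μ with hc
  have hprop : ∀ k, A i k ≠ 0 → A j k = c * A i k := fun k hk =>
    hmodel.totalEffect_eq_of_indepFun_residual hA hres hk
  have hii := totalEffect_self hG hmodel.adj_of_ne_zero hA i
  -- With slope 0 the residual would be `X j` itself up to a constant, against dependence.
  have hc0 : c ≠ 0 := by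
    intro h0
    refine hdep ?_
    have := hmodel.indepFun_sub_mul hA hprop
    simpa [h0] using this
  have hji : A j i ≠ 0 := by
    rw [hprop i (by rw [hii]; exact one_ne_zero), hii, mul_one]
    exact hc0
  have hanc : IsAncestor G i j := by
    rcases reflTransGen_iff_eq_or_transGen.1
      (reflTransGen_of_totalEffect_ne_zero hG hmodel.adj_of_ne_zero hA hji) with h | h
    · exact absurd h.symm hne
    · exact h
  refine ⟨⟨?_, ?_⟩, hanc⟩
  · obtain ⟨p, hp, hact, -⟩ := exists_active_frontdoorPath hG hanc
    exact ⟨p, Or.inl hp, hact⟩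
  · rintro ⟨p, hp, hact⟩
    obtain ⟨u, hui, hsep⟩ := hp.exists_parent hact
    have huj : u ≠ j := by
      rintro rfl
      exact hG _ (hanc.tail hui)
    have hu_ne : u ≠ i := by
      rintro rfl
      exact hG _ (TransGen.single hui)
    -- Noise in `X u` comes from an ancestor of `u` or from `u` itself, hence from an ancestor of
    -- `i`; by faithfulness it occurs in `X i`. The residual noise therefore meets neither `X i` nor
    -- `X u`.
    have hind := hmodel.indepFun_linear_observed hA (Finset.univ.filter fun k => A i k = 0)
      (fun k => A j k - c * A i k) (Z := {i}) (b := u) (by simp) (by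
        intro k hk
        by_contra hk0
        have hku := reflTransGen_of_totalEffect_ne_zero hG hmodel.adj_of_ne_zero hA hk0
        exact hmodel.totalEffect_ne_zero hA hfaithful (TransGen.tail' hku hui)
          (Finset.mem_filter.1 hk).2)
    have hcond := condIndepCoord_of_indepFun (hmodel.measurable hA) (a := j) (b := u) (Z := {i})
      (h := fun y => c * y ⟨i, rfl⟩) (by fun_prop) (fun ω => by
        rw [← hmodel.sub_mul_eq_sum hA hprop ω]
        ring) hind
    exact hsep (hfaithful u j {i} huj (by simpa using hu_ne) (by simpa using hne.symm) hcond)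

end Model

end LinearSEM

theorem mainTheorem7 {V Ω : Type*} [Fintype V] [MeasurableSpace Ω]
    (μ : Measure Ω) [IsProbabilityMeasure μ]
    (G : Digraph V) (B : Matrix V V ℝ) (ε X : V → Ω → ℝ)
    (hmodel : LinearSEM.IsLiNGAM μ G B ε X)
    (hfaithful : LinearSEM.IsFaithful μ G X)
    (i j : V) (hij : i ≠ j) :
    (LinearSEM.AP3 G i j ↔
      ¬ IndepFun (X i) (X j) μ ∧
        ((IndepFun (X i) (LinearSEM.residual μ (X j) (X i)) μ ∧
            ¬ IndepFun (X j) (LinearSEM.residual μ (X i) (X j)) μ) ∨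
          (¬ IndepFun (X i) (LinearSEM.residual μ (X j) (X i)) μ ∧
            IndepFun (X j) (LinearSEM.residual μ (X i) (X j)) μ))) ∧
    ((LinearSEM.AP3 G i j ∧ LinearSEM.IsAncestor G i j) ↔
      ¬ IndepFun (X i) (X j) μ ∧
        (IndepFun (X i) (LinearSEM.residual μ (X j) (X i)) μ ∧
          ¬ IndepFun (X j) (LinearSEM.residual μ (X i) (X j)) μ)) ∧
    ((LinearSEM.AP3 G i j ∧ LinearSEM.IsAncestor G j i) ↔
      ¬ IndepFun (X i) (X j) μ ∧
        (¬ IndepFun (X i) (LinearSEM.residual μ (X j) (X i)) μ ∧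
          IndepFun (X j) (LinearSEM.residual μ (X i) (X j)) μ)) := by
  classical
  obtain ⟨A, hA⟩ := LinearSEM.exists_eq_one_add_mul hmodel.acyclic hmodel.adj_of_ne_zero
  have hdep : ¬ IndepFun (X i) (X j) μ → ¬ IndepFun (X j) (X i) μ := fun h h' => h h'.symm
  have h1 : (LinearSEM.AP3 G i j ∧ LinearSEM.IsAncestor G i j) ↔
      ¬ IndepFun (X i) (X j) μ ∧
        (IndepFun (X i) (LinearSEM.residual μ (X j) (X i)) μ ∧
          ¬ IndepFun (X j) (LinearSEM.residual μ (X i) (X j)) μ) :=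
    ⟨fun h => hmodel.of_AP3 hA hfaithful h.1 h.2,
      fun h => hmodel.AP3_of_indepFun_residual hA hfaithful hij h.1 h.2.1⟩
  -- The same two lemmas with `i` and `j` exchanged, by symmetry of the AP3 relation.
  have h2 : (LinearSEM.AP3 G i j ∧ LinearSEM.IsAncestor G j i) ↔
      ¬ IndepFun (X i) (X j) μ ∧
        (¬ IndepFun (X i) (LinearSEM.residual μ (X j) (X i)) μ ∧
          IndepFun (X j) (LinearSEM.residual μ (X i) (X j)) μ) := by
    constructor
    · intro h
      obtain ⟨h3, h4, h5⟩ := hmodel.of_AP3 hA hfaithful h.1.symm h.2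
      exact ⟨fun h' => h3 h'.symm, h5, h4⟩
    · intro h
      obtain ⟨h3, h4⟩ := hmodel.AP3_of_indepFun_residual hA hfaithful hij.symm (hdep h.1) h.2.2
      exact ⟨h3.symm, h4⟩
  refine ⟨⟨fun h => ?_, fun h => ?_⟩, h1, h2⟩
  · rcases h.isAncestor_or with h' | h'
    · exact ⟨(h1.1 ⟨h, h'⟩).1, Or.inl (h1.1 ⟨h, h'⟩).2⟩
    · exact ⟨(h2.1 ⟨h, h'⟩).1, Or.inr (h2.1 ⟨h, h'⟩).2⟩
  · rcases h.2 with h' | h'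
    · exact (h1.2 ⟨h.1, h'⟩).1
    · exact (h2.2 ⟨h.1, h'⟩).1
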